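/- For a commutative ring $A$, a symmetric bilinear space over $A$ is a finitely generated projective $A$-module $P$ with a symmetric bilinear form $b\colon P\times P\to A$ whose adjoint $P\to\operatorname{Hom}_A(P,A)$ is an isomorphism. It is metabolic if $P$ has a direct summand $L$ with $L=L^\perp$. The Witt group $W(A)$ is the Grothendieck group of the monoid of isometry classes of symmetric bilinear spaces under orthogonal sum, modulo the subgroup generated by the classes of metabolic spaces. A ring homomorphism $A\to B$ induces a homomorphism $W(A)\to W(B)$ by extension of scalars. For $n\ge 0$ let $\mathcal R_n$ be the $\mathbb R[t_1,\dots,t_n]$-algebra of real analytic functions defined on an open neighborhood of the cube $[0,1]^n\subset\mathbb R^n$, where two functions are identified if they agree on a neighborhood of $[0,1]^n$. Consider the inclusions $$\mathbb R\hookrightarrow \mathbb R[t_1,\dots,t_n]\hookrightarrow \mathcal R_n\hookrightarrow \mathbb R[[t_1,\dots,t_n]],$$ where the first map is the inclusion of the constants, the second regards a polynomial as an analytic function, and the third sends an analytic function to its Taylor series at the origin. Then for every $n\ge 0$ each of these three maps induces an isomorphism on Witt groups. -/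

import Mathlib

open scoped TensorProduct Topology

universe u

section Witt

/-- A symmetric bilinear space over a commutative ring `A`: a finitely generated projective
`A`-module together with a symmetric bilinear form whose adjoint `P → Hom(P, A)` is bijective. -/
structure SymmBilinSpace (A : Type u) [CommRing A] where
  carrier : Type u
  [addCommGroup : AddCommGroup carrier]
  [module : Module A carrier]
  [finite : Module.Finite A carrier]
  [projective : Module.Projective A carrier]
  form : LinearMap.BilinForm A carrier
  symm : form.IsSymm
  unimodular : Function.Bijective form

namespace SymmBilinSpace

attribute [instance] addCommGroup module finite projective

variable {A : Type u} [CommRing A] (B : Type u) [CommRing B] [Algebra A B]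

/-- Isometry of symmetric bilinear spaces. -/
def Isometric (X Y : SymmBilinSpace A) : Prop := X.form.Equivalent Y.form

/-- `X` is metabolic if it has a Lagrangian: a direct summand that is its own orthogonal
complement. -/
def IsMetabolic (X : SymmBilinSpace A) : Prop :=
  ∃ L : Submodule A X.carrier, (∃ M : Submodule A X.carrier, IsCompl L M) ∧
    X.form.orthogonal L = L

/-- The zero space. -/
def zero (A : Type u) [CommRing A] : SymmBilinSpace A where
  carrier := PUnit.{u + 1}
  form := 0
  symm := ⟨fun _ _ => rfl⟩
  unimodular := ⟨fun _ _ _ => rfl, fun f => ⟨0, LinearMap.ext fun x => by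
    rw [Subsingleton.elim x 0, map_zero, map_zero]⟩⟩

/-- The orthogonal sum of two symmetric bilinear forms. -/
def sumForm {M N : Type u} [AddCommGroup M] [Module A M] [AddCommGroup N] [Module A N]
    (b : LinearMap.BilinForm A M) (c : LinearMap.BilinForm A N) : LinearMap.BilinForm A (M × N) :=
  b.compl₁₂ (LinearMap.fst A M N) (LinearMap.fst A M N) +
    c.compl₁₂ (LinearMap.snd A M N) (LinearMap.snd A M N)

theorem sumForm_apply {M N : Type u} [AddCommGroup M] [Module A M] [AddCommGroup N] [Module A N]
    (b : LinearMap.BilinForm A M) (c : LinearMap.BilinForm A N) (x y : M × N) :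
    sumForm b c x y = b x.1 y.1 + c x.2 y.2 := rfl

/-- The orthogonal sum of two symmetric bilinear spaces. -/
def sum (X Y : SymmBilinSpace A) : SymmBilinSpace A where
  carrier := X.carrier × Y.carrier
  form := sumForm X.form Y.form
  symm := ⟨fun x y => by simp only [sumForm_apply, X.symm.eq x.1, Y.symm.eq x.2]⟩
  unimodular := by
    constructor
    · rw [injective_iff_map_eq_zero]
      intro x hx
      have h1 : X.form x.1 = 0 := by
        ext m
        simpa [sumForm_apply] using LinearMap.congr_fun hx (m, 0)
      have h2 : Y.form x.2 = 0 := by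
        ext m
        simpa [sumForm_apply] using LinearMap.congr_fun hx (0, m)
      exact Prod.ext ((injective_iff_map_eq_zero _).1 X.unimodular.1 _ h1)
        ((injective_iff_map_eq_zero _).1 Y.unimodular.1 _ h2)
    · intro f
      obtain ⟨x, hx⟩ := X.unimodular.2 (f ∘ₗ LinearMap.inl A _ _)
      obtain ⟨y, hy⟩ := Y.unimodular.2 (f ∘ₗ LinearMap.inr A _ _)
      refine ⟨(x, y), LinearMap.ext fun z => ?_⟩
      rw [sumForm_apply, hx, hy, LinearMap.comp_apply, LinearMap.comp_apply, ← map_add]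
      simp

/-- A unimodular form on a finitely generated projective module represents a dual basis. -/
theorem exists_dual_family (X : SymmBilinSpace A) : ∃ (n : ℕ) (x y : Fin n → X.carrier),
    ∀ z, z = ∑ i, X.form (y i) z • x i := by
  obtain ⟨n, f, g, -, -, h⟩ := Module.Finite.exists_comp_eq_id_of_projective A X.carrier
  choose y hy using fun i : Fin n => X.unimodular.2 (LinearMap.proj i ∘ₗ g)
  refine ⟨n, fun i => f (Pi.single i 1), y, fun z => ?_⟩
  have := LinearMap.congr_fun h z
  rw [LinearMap.comp_apply, LinearMap.id_apply] at this
  conv_lhs => rw [← this, LinearMap.pi_apply_eq_sum_univ f]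
  refine Finset.sum_congr rfl fun i _ => ?_
  rw [hy]
  have : (Pi.single i 1 : Fin n → A) = fun j => if i = j then 1 else 0 := by
    ext j
    simp [Pi.single_apply, eq_comm]
  rw [← this]
  rfl

theorem baseChange_symm (X : SymmBilinSpace A) (x y : B ⊗[A] X.carrier) :
    X.form.baseChange B x y = X.form.baseChange B y x :=
  (LinearMap.BilinForm.IsSymm.baseChange B ⟨X.symm.eq⟩).eq x y

/-- Extension of scalars of a symmetric bilinear space. -/
noncomputable def baseChange (X : SymmBilinSpace A) : SymmBilinSpace B where
  carrier := B ⊗[A] X.carrier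
  form := X.form.baseChange B
  symm := ⟨X.baseChange_symm B⟩
  unimodular := by
    obtain ⟨n, x, y, h⟩ := X.exists_dual_family
    have key : ∀ z : B ⊗[A] X.carrier,
        z = ∑ i, X.form.baseChange B (1 ⊗ₜ y i) z • ((1 : B) ⊗ₜ[A] x i) := by
      intro z
      induction z with
      | zero => simp
      | add z w hz hw =>
        conv_lhs => rw [hz, hw]
        simp only [map_add, add_smul, Finset.sum_add_distrib]
      | tmul b p =>
        conv_lhs => rw [h p, TensorProduct.tmul_sum]
        refine Finset.sum_congr rfl fun i _ => ?_
        rw [LinearMap.BilinForm.baseChange_tmul, TensorProduct.smul_tmul', one_mul,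
          TensorProduct.tmul_smul, TensorProduct.smul_tmul', smul_eq_mul, mul_one]
    constructor
    · rw [injective_iff_map_eq_zero]
      intro z hz
      rw [key z]
      refine Finset.sum_eq_zero fun i _ => ?_
      rw [X.baseChange_symm B, hz, LinearMap.zero_apply, zero_smul]
    · intro f
      refine ⟨∑ i, f (1 ⊗ₜ x i) • ((1 : B) ⊗ₜ[A] y i), LinearMap.ext fun z => ?_⟩
      conv_rhs => rw [key z]
      simp [mul_comm]

theorem Isometric.sum {X X' Y Y' : SymmBilinSpace A} (h : X.Isometric X') (k : Y.Isometric Y') :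
    (X.sum Y).Isometric (X'.sum Y') := by
  obtain ⟨e⟩ := h
  obtain ⟨f⟩ := k
  exact ⟨{ e.toLinearEquiv.prodCongr f.toLinearEquiv with
    map_app' := fun x y => congrArg₂ (· + ·) (e.map_app' x.1 y.1) (f.map_app' x.2 y.2) }⟩

theorem Isometric.baseChange {X Y : SymmBilinSpace A} (h : X.Isometric Y) :
    (X.baseChange B).Isometric (Y.baseChange B) := by
  obtain ⟨e⟩ := h
  refine ⟨{ e.toLinearEquiv.baseChange A B X.carrier Y.carrier with map_app' := ?_ }⟩
  change ∀ z w : B ⊗[A] X.carrier, Y.form.baseChange B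
    (e.toLinearEquiv.baseChange A B X.carrier Y.carrier z)
    (e.toLinearEquiv.baseChange A B X.carrier Y.carrier w) = X.form.baseChange B z w
  intro z w
  induction z with
  | zero => simp
  | add z z' hz hz' => simp only [map_add, LinearMap.add_apply, hz, hz']
  | tmul b p =>
    induction w with
    | zero => simp
    | add w w' hw hw' => simp only [map_add, hw, hw']
    | tmul c q =>
      rw [LinearEquiv.baseChange_tmul, LinearEquiv.baseChange_tmul,
        LinearMap.BilinForm.baseChange_tmul, LinearMap.BilinForm.baseChange_tmul]
      exact congrArg (· • (b * c)) (e.map_app' p q)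

theorem baseChange_sum (X Y : SymmBilinSpace A) :
    ((X.sum Y).baseChange B).Isometric ((X.baseChange B).sum (Y.baseChange B)) := by
  refine ⟨{ TensorProduct.prodRight A B B X.carrier Y.carrier with map_app' := ?_ }⟩
  change ∀ z w : B ⊗[A] (X.carrier × Y.carrier),
    sumForm (X.form.baseChange B) (Y.form.baseChange B)
      (TensorProduct.prodRight A B B X.carrier Y.carrier z)
      (TensorProduct.prodRight A B B X.carrier Y.carrier w) =
    (sumForm X.form Y.form).baseChange B z w
  intro z w
  induction z with
  | zero => simp
  | add z z' hz hz' => simp only [map_add, LinearMap.add_apply, hz, hz']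
  | tmul b p =>
    induction w with
    | zero => simp
    | add w w' hw hw' => simp only [map_add, hw, hw']
    | tmul c q =>
      rw [TensorProduct.prodRight_tmul, TensorProduct.prodRight_tmul, sumForm_apply,
        LinearMap.BilinForm.baseChange_tmul, LinearMap.BilinForm.baseChange_tmul,
        LinearMap.BilinForm.baseChange_tmul, sumForm_apply, add_smul]

theorem baseChange_zero : ((zero A).baseChange B).Isometric (zero B) := by
  have : Subsingleton (B ⊗[A] PUnit.{u + 1}) := inferInstance
  have e : B ⊗[A] PUnit.{u + 1} ≃ₗ[B] PUnit.{u + 1} := 0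
  refine ⟨{ e with map_app' := ?_ }⟩
  change ∀ z w : B ⊗[A] PUnit.{u + 1}, (0 : B) =
    LinearMap.BilinForm.baseChange B (0 : LinearMap.BilinForm A PUnit.{u + 1}) z w
  intro z w
  rw [Subsingleton.elim z 0, map_zero, LinearMap.zero_apply]

theorem baseChange_isCompl {M : Type u} [AddCommGroup M] [Module A M] {L N : Submodule A M}
    (h : IsCompl L N) : IsCompl (L.baseChange B) (N.baseChange B) := by
  constructor
  · set π : M →ₗ[A] M := L.subtype ∘ₗ L.projectionOnto N h with hπ
    rw [Submodule.disjoint_def]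
    intro z hz hz'
    obtain ⟨v, rfl⟩ := hz
    obtain ⟨w, hw⟩ := hz'
    have h1 : π.baseChange B (L.subtype.baseChange B v) = L.subtype.baseChange B v := by
      rw [← LinearMap.comp_apply, ← LinearMap.baseChange_comp]
      congr 2
      ext l
      simp [hπ]
    have h2 : π.baseChange B (N.subtype.baseChange B w) = 0 := by
      have : π ∘ₗ N.subtype = 0 := by
        ext l
        simp [hπ]
      rw [← LinearMap.comp_apply, ← LinearMap.baseChange_comp, this, LinearMap.baseChange_zero,
        LinearMap.zero_apply]
    rw [← h1, ← hw, h2]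
  · rw [codisjoint_iff, eq_top_iff]
    rintro z -
    induction z with
    | zero => exact zero_mem _
    | add z w hz hw => exact add_mem hz hw
    | tmul b p =>
      obtain ⟨l, hl, m, hm, rfl⟩ := Submodule.mem_sup.1 (h.sup_eq_top ▸ Submodule.mem_top (x := p))
      rw [TensorProduct.tmul_add]
      exact Submodule.add_mem_sup (Submodule.tmul_mem_baseChange_of_mem _ hl)
        (Submodule.tmul_mem_baseChange_of_mem _ hm)

theorem IsMetabolic.baseChange {X : SymmBilinSpace A} (h : X.IsMetabolic) :
    (X.baseChange B).IsMetabolic := by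
  obtain ⟨L, ⟨N, hLN⟩, hL⟩ := h
  have iso : ∀ l ∈ L, ∀ m ∈ L, X.form l m = 0 := fun l hl m hm =>
    LinearMap.BilinForm.mem_orthogonal_iff.1 (hL.symm ▸ hm) l hl
  refine ⟨L.baseChange B, ⟨N.baseChange B, baseChange_isCompl B hLN⟩, le_antisymm ?_ ?_⟩
  · obtain ⟨n, x, y, hxy⟩ := X.exists_dual_family
    set π : X.carrier →ₗ[A] X.carrier := L.subtype ∘ₗ L.projectionOnto N hLN with hπ
    have hπL : ∀ p, π p ∈ L := fun p => (L.projectionOnto N hLN p).2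
    have hπl : ∀ l ∈ L, π l = l := fun l hl => by
      rw [hπ, LinearMap.comp_apply, Submodule.projectionOnto_apply_of_mem_left hLN hl]
      rfl
    have key : ∀ p, p - ∑ i, X.form (π (x i)) p • y i ∈ L := by
      intro p
      rw [← hL, LinearMap.BilinForm.mem_orthogonal_iff]
      intro l hl
      have e : l = ∑ i, X.form (y i) l • π (x i) := by
        conv_lhs => rw [← hπl l hl, hxy l]
        simp
      rw [map_sub, sub_eq_zero]
      conv_lhs => rw [e]
      simp only [map_sum, map_smul, LinearMap.sum_apply, LinearMap.smul_apply, smul_eq_mul]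
      exact Finset.sum_congr rfl fun i _ => by rw [X.symm.eq l, mul_comm]
    have key' : ∀ z : B ⊗[A] X.carrier, z - ∑ i, X.form.baseChange B (1 ⊗ₜ π (x i)) z •
        ((1 : B) ⊗ₜ[A] y i) ∈ L.baseChange B := by
      intro z
      induction z with
      | zero => simp
      | add z w hz hw =>
        convert add_mem hz hw using 1
        simp only [map_add, add_smul, Finset.sum_add_distrib]
        abel
      | tmul b p =>
        convert Submodule.tmul_mem_baseChange_of_mem b (key p) using 1
        rw [TensorProduct.tmul_sub, TensorProduct.tmul_sum]
        congr 1
        refine Finset.sum_congr rfl fun i _ => ?_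
        rw [LinearMap.BilinForm.baseChange_tmul, TensorProduct.smul_tmul', one_mul,
          TensorProduct.tmul_smul, TensorProduct.smul_tmul', smul_eq_mul, mul_one]
    intro z hz
    have hz' : ∀ w ∈ L.baseChange B, X.form.baseChange B w z = 0 :=
      LinearMap.BilinForm.mem_orthogonal_iff.1 hz
    have h0 : ∑ i, X.form.baseChange B (1 ⊗ₜ π (x i)) z • ((1 : B) ⊗ₜ[A] y i) = 0 :=
      Finset.sum_eq_zero fun i _ => by
        rw [hz' _ (Submodule.tmul_mem_baseChange_of_mem _ (hπL _)), zero_smul]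
    have := key' z
    rw [h0] at this
    exact (sub_zero (G := B ⊗[A] X.carrier) z) ▸ this
  · have iso' : ∀ v w : B ⊗[A] L, X.form.baseChange B (L.subtype.baseChange B v)
        (L.subtype.baseChange B w) = 0 := by
      intro v w
      induction v with
      | zero => simp
      | add v v' hv hv' => rw [map_add, map_add, LinearMap.add_apply, hv, hv', add_zero]
      | tmul b l =>
        induction w with
        | zero => simp
        | add w w' hw hw' => rw [map_add, map_add, hw, hw', add_zero]
        | tmul c m =>
          rw [LinearMap.baseChange_tmul, LinearMap.baseChange_tmul,
            LinearMap.BilinForm.baseChange_tmul, Submodule.subtype_apply, Submodule.subtype_apply,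
            iso l l.2 m m.2, zero_smul]
    rintro _ ⟨w, rfl⟩
    refine LinearMap.BilinForm.mem_orthogonal_iff.2 ?_
    rintro _ ⟨v, rfl⟩
    exact iso' v w

instance setoid (A : Type u) [CommRing A] : Setoid (SymmBilinSpace A) where
  r := Isometric
  iseqv := ⟨fun X => .refl X.form, fun h => h.symm, fun h k => h.trans k⟩

end SymmBilinSpace

/-- The isometry classes of symmetric bilinear spaces over `A`. -/
def BilinClass (A : Type u) [CommRing A] : Type (u + 1) := Quotient (SymmBilinSpace.setoid A)

namespace BilinClass

open SymmBilinSpace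

variable {A : Type u} [CommRing A]

/-- The isometry class of a space. -/
def mk (X : SymmBilinSpace A) : BilinClass A := Quotient.mk _ X

instance : Zero (BilinClass A) := ⟨mk (zero A)⟩

instance : Add (BilinClass A) :=
  ⟨Quotient.map₂ SymmBilinSpace.sum fun _ _ h _ _ k => h.sum k⟩

/-- Isometry classes form a commutative monoid under orthogonal sum. -/
instance : AddCommMonoid (BilinClass A) where
  add_assoc := by
    rintro ⟨X⟩ ⟨Y⟩ ⟨Z⟩
    exact Quotient.sound ⟨{ LinearEquiv.prodAssoc A X.carrier Y.carrier Z.carrier with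
      map_app' := fun x y => (add_assoc (X.form x.1.1 y.1.1) (Y.form x.1.2 y.1.2)
        (Z.form x.2 y.2)).symm }⟩
  zero_add := by
    rintro ⟨X⟩
    exact Quotient.sound ⟨{ LinearEquiv.uniqueProd (R := A) (M := X.carrier)
      (M₂ := PUnit.{u + 1}) with map_app' := fun x y => (zero_add (X.form x.2 y.2)).symm }⟩
  add_zero := by
    rintro ⟨X⟩
    exact Quotient.sound ⟨{ LinearEquiv.prodUnique (R := A) (M := X.carrier)
      (M₂ := PUnit.{u + 1}) with map_app' := fun x y => (add_zero (X.form x.1 y.1)).symm }⟩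
  add_comm := by
    rintro ⟨X⟩ ⟨Y⟩
    exact Quotient.sound ⟨{ LinearEquiv.prodComm A X.carrier Y.carrier with
      map_app' := fun x y => add_comm (Y.form x.2 y.2) (X.form x.1 y.1) }⟩
  nsmul := nsmulRec

/-- Extension of scalars along a ring homomorphism, on isometry classes. -/
noncomputable def map {B : Type u} [CommRing B] (f : A →+* B) : BilinClass A →+ BilinClass B :=
  letI := f.toAlgebra
  { toFun := Quotient.map (SymmBilinSpace.baseChange B) fun _ _ h => h.baseChange B
    map_zero' := Quotient.sound (baseChange_zero B)
    map_add' := by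
      rintro ⟨X⟩ ⟨Y⟩
      exact Quotient.sound (baseChange_sum B X Y) }

end BilinClass

open Algebra (GrothendieckAddGroup)

/-- The Grothendieck-Witt group of symmetric bilinear spaces. -/
abbrev GrothendieckWitt (A : Type u) [CommRing A] : Type (u + 1) :=
  GrothendieckAddGroup (BilinClass A)

namespace GrothendieckWitt

variable {A : Type u} [CommRing A]

/-- The class of a space in the Grothendieck-Witt group. -/
noncomputable def cls (X : SymmBilinSpace A) : GrothendieckWitt A :=
  GrothendieckAddGroup.of (BilinClass.mk X)

/-- Extension of scalars on Grothendieck-Witt groups. -/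
noncomputable def map {B : Type u} [CommRing B] (f : A →+* B) :
    GrothendieckWitt A →+ GrothendieckWitt B :=
  GrothendieckAddGroup.lift (GrothendieckAddGroup.of.comp (BilinClass.map f))

theorem map_cls {B : Type u} [CommRing B] (f : A →+* B) (X : SymmBilinSpace A) :
    map f (cls X) = letI := f.toAlgebra; cls (X.baseChange B) := by
  exact DFunLike.congr_fun (GrothendieckAddGroup.lift.symm_apply_apply
    (GrothendieckAddGroup.of.comp (BilinClass.map f))) (BilinClass.mk X)

/-- The subgroup generated by the metabolic spaces. -/
def metabolic (A : Type u) [CommRing A] : AddSubgroup (GrothendieckWitt A) :=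
  AddSubgroup.closure {w | ∃ X : SymmBilinSpace A, X.IsMetabolic ∧ w = cls X}

end GrothendieckWitt

/-- The Witt group: the Grothendieck-Witt group modulo metabolic spaces. -/
abbrev WittGroup (A : Type u) [CommRing A] : Type (u + 1) :=
  GrothendieckWitt A ⧸ GrothendieckWitt.metabolic A

/-- The homomorphism of Witt groups induced by extension of scalars along a ring homomorphism:
the class of `X` goes to the class of `B ⊗ X`. -/
noncomputable def WittGroup.map {A B : Type u} [CommRing A] [CommRing B] (f : A →+* B) :
    WittGroup A →+ WittGroup B :=
  QuotientAddGroup.map _ _ (GrothendieckWitt.map f) <| by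
    rw [GrothendieckWitt.metabolic, AddSubgroup.closure_le]
    rintro _ ⟨X, hX, rfl⟩
    let := f.toAlgebra
    rw [SetLike.mem_coe, AddSubgroup.mem_comap, GrothendieckWitt.map_cls]
    exact AddSubgroup.subset_closure ⟨_, hX.baseChange B, rfl⟩

end Witt

section Analytic

open Filter

/-- The compact unit cube `[0,1]^n` in `ℝ^n`. -/
def unitCube (n : ℕ) : Set (Fin n → ℝ) := Set.Icc 0 1

theorem zero_mem_unitCube (n : ℕ) : (0 : Fin n → ℝ) ∈ unitCube n :=
  ⟨le_rfl, fun _ => zero_le_one⟩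

/-- The germ of `f` along the unit cube. -/
def cubeGerm {n : ℕ} (f : (Fin n → ℝ) → ℝ) : Germ (𝓝ˢ (unitCube n)) ℝ := f

/-- `f` is real analytic on an open neighborhood of the unit cube. -/
def IsCubeAnalytic {n : ℕ} (f : (Fin n → ℝ) → ℝ) : Prop :=
  ∃ U : Set (Fin n → ℝ), IsOpen U ∧ unitCube n ⊆ U ∧ AnalyticOnNhd ℝ f U

theorem isCubeAnalytic_iff {n : ℕ} {f : (Fin n → ℝ) → ℝ} :
    IsCubeAnalytic f ↔ AnalyticOnNhd ℝ f (unitCube n) :=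
  ⟨fun ⟨_, _, h, hf⟩ => hf.mono h, fun h => ⟨{x | AnalyticAt ℝ f x}, isOpen_analyticAt ℝ f, h,
    fun _ hx => hx⟩⟩

/-- The ring `R_n` of real analytic functions defined on an open neighborhood of `[0,1]^n`; two of
them are identified if they agree on a neighborhood of `[0,1]^n`. -/
def CubeAnalytic (n : ℕ) : Subring (Germ (𝓝ˢ (unitCube n)) ℝ) where
  carrier := {φ | ∃ f, IsCubeAnalytic f ∧ cubeGerm f = φ}
  mul_mem' := by
    rintro _ _ ⟨f, hf, rfl⟩ ⟨g, hg, rfl⟩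
    exact ⟨f * g, isCubeAnalytic_iff.2 ((isCubeAnalytic_iff.1 hf).mul (isCubeAnalytic_iff.1 hg)),
      rfl⟩
  one_mem' := ⟨1, isCubeAnalytic_iff.2 analyticOnNhd_const, rfl⟩
  add_mem' := by
    rintro _ _ ⟨f, hf, rfl⟩ ⟨g, hg, rfl⟩
    exact ⟨f + g, isCubeAnalytic_iff.2 ((isCubeAnalytic_iff.1 hf).add (isCubeAnalytic_iff.1 hg)),
      rfl⟩
  zero_mem' := ⟨0, isCubeAnalytic_iff.2 analyticOnNhd_const, rfl⟩
  neg_mem' := by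
    rintro _ ⟨f, hf, rfl⟩
    exact ⟨-f, isCubeAnalytic_iff.2 (isCubeAnalytic_iff.1 hf).neg, rfl⟩

namespace CubeAnalytic

variable {n : ℕ}

/-- The element of `R_n` given by a function that is analytic near the cube. -/
def mk (f : (Fin n → ℝ) → ℝ) (hf : IsCubeAnalytic f) : CubeAnalytic n := ⟨cubeGerm f, f, hf, rfl⟩

theorem exists_eq_mk (φ : CubeAnalytic n) : ∃ f hf, φ = mk f hf := by
  obtain ⟨_, f, hf, rfl⟩ := φ
  exact ⟨f, hf, rfl⟩

theorem mk_eq_mk {f g : (Fin n → ℝ) → ℝ} {hf : IsCubeAnalytic f} {hg : IsCubeAnalytic g}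
    (h : f =ᶠ[𝓝ˢ (unitCube n)] g) : mk f hf = mk g hg :=
  Subtype.ext (Germ.coe_eq.2 h)

/-- Constants, as elements of `R_n`. -/
def const (n : ℕ) : ℝ →+* CubeAnalytic n where
  toFun c := mk (fun _ => c) (isCubeAnalytic_iff.2 analyticOnNhd_const)
  map_one' := rfl
  map_mul' _ _ := rfl
  map_zero' := rfl
  map_add' _ _ := rfl

/-- The coordinate function `t_i`, as an element of `R_n`. -/
def coord (i : Fin n) : CubeAnalytic n :=
  mk (fun x => x i) (isCubeAnalytic_iff.2 fun x _ =>
    (ContinuousLinearMap.proj (R := ℝ) (φ := fun _ : Fin n => ℝ) i).analyticAt x)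

/-- The inclusion `ℝ[t_1, …, t_n] → R_n`: a polynomial is regarded as an analytic function. -/
noncomputable def ofPolynomial (n : ℕ) : MvPolynomial (Fin n) ℝ →+* CubeAnalytic n :=
  MvPolynomial.eval₂Hom (const n) coord

/-- The value of an element of `R_n` at the origin. -/
def valueAtZero (φ : CubeAnalytic n) : ℝ :=
  φ.1.liftOn (fun f => f 0) fun _ _ h => h.self_of_nhdsSet (zero_mem_unitCube n)

/-- The `i`-th partial derivative of a function. -/
noncomputable def partialFun (i : Fin n) (f : (Fin n → ℝ) → ℝ) (x : Fin n → ℝ) : ℝ :=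
  fderiv ℝ f x (Pi.single i 1)

theorem _root_.IsCubeAnalytic.partialFun {f : (Fin n → ℝ) → ℝ} (hf : IsCubeAnalytic f) (i : Fin n) :
    IsCubeAnalytic (CubeAnalytic.partialFun i f) :=
  isCubeAnalytic_iff.2 fun x hx =>
    ((ContinuousLinearMap.apply ℝ ℝ (Pi.single i (1 : ℝ) : Fin n → ℝ)).analyticAt _).comp
      ((isCubeAnalytic_iff.1 hf) x hx).fderiv

theorem partialFun_eventuallyEq (i : Fin n) {f g : (Fin n → ℝ) → ℝ}
    (h : f =ᶠ[𝓝ˢ (unitCube n)] g) : partialFun i f =ᶠ[𝓝ˢ (unitCube n)] partialFun i g :=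
  h.eventually_nhdsSet.mono fun x hx => by
    rw [partialFun, partialFun, EventuallyEq.fderiv_eq hx]

/-- The `i`-th partial derivative of an element of `R_n`, as a function `R_n → R_n`. -/
noncomputable def partialDerivFun (i : Fin n) (φ : CubeAnalytic n) : CubeAnalytic n :=
  ⟨φ.1.map' (partialFun i) fun _ _ h => partialFun_eventuallyEq i h, by
    obtain ⟨_, f, hf, rfl⟩ := φ
    exact ⟨_, hf.partialFun i, rfl⟩⟩

theorem partialDerivFun_mk (i : Fin n) (f : (Fin n → ℝ) → ℝ) (hf : IsCubeAnalytic f) :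
    partialDerivFun i (mk f hf) = mk (partialFun i f) (hf.partialFun i) := rfl

theorem eventually_analyticAt {f : (Fin n → ℝ) → ℝ} (hf : IsCubeAnalytic f) :
    ∀ᶠ x in 𝓝ˢ (unitCube n), AnalyticAt ℝ f x :=
  (isOpen_analyticAt ℝ f).mem_nhdsSet.2 (isCubeAnalytic_iff.1 hf)

/-- The partial derivative `∂/∂t_i` on `R_n`. -/
noncomputable def partialDeriv (i : Fin n) : AddMonoid.End (CubeAnalytic n) :=
  AddMonoidHom.mk' (partialDerivFun i) fun φ ψ => by
    obtain ⟨f, hf, rfl⟩ := exists_eq_mk φ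
    obtain ⟨g, hg, rfl⟩ := exists_eq_mk ψ
    refine mk_eq_mk (hf := (isCubeAnalytic_iff.2
      ((isCubeAnalytic_iff.1 hf).add (isCubeAnalytic_iff.1 hg))).partialFun i)
      (hg := isCubeAnalytic_iff.2 ((isCubeAnalytic_iff.1 (hf.partialFun i)).add
        (isCubeAnalytic_iff.1 (hg.partialFun i)))) ?_
    filter_upwards [eventually_analyticAt hf, eventually_analyticAt hg] with x h k
    exact DFunLike.congr_fun (fderiv_add h.differentiableAt k.differentiableAt) (Pi.single i 1)

theorem partialDeriv_mul (i : Fin n) (φ ψ : CubeAnalytic n) :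
    partialDeriv i (φ * ψ) = φ * partialDeriv i ψ + ψ * partialDeriv i φ := by
  obtain ⟨f, hf, rfl⟩ := exists_eq_mk φ
  obtain ⟨g, hg, rfl⟩ := exists_eq_mk ψ
  have hfa := isCubeAnalytic_iff.1 hf
  have hga := isCubeAnalytic_iff.1 hg
  refine mk_eq_mk (hf := (isCubeAnalytic_iff.2 (hfa.mul hga)).partialFun i)
    (hg := isCubeAnalytic_iff.2 ((hfa.mul (isCubeAnalytic_iff.1 (hg.partialFun i))).add
      (hga.mul (isCubeAnalytic_iff.1 (hf.partialFun i))))) ?_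
  filter_upwards [eventually_analyticAt hf, eventually_analyticAt hg] with x h k
  exact DFunLike.congr_fun (fderiv_mul h.differentiableAt k.differentiableAt) (Pi.single i 1)

theorem partialFun_comm (i j : Fin n) {f : (Fin n → ℝ) → ℝ} {x : Fin n → ℝ}
    (h : AnalyticAt ℝ f x) : partialFun i (partialFun j f) x = partialFun j (partialFun i f) x := by
  have hs : IsSymmSndFDerivAt ℝ f x := h.contDiffAt.isSymmSndFDerivAt_of_omega
  have hd : DifferentiableAt ℝ (fderiv ℝ f) x := h.fderiv.differentiableAt
  have key : ∀ k l : Fin n, partialFun k (partialFun l f) x =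
      fderiv ℝ (fderiv ℝ f) x (Pi.single k 1) (Pi.single l 1) := by
    intro k l
    change fderiv ℝ (fun y => fderiv ℝ f y (Pi.single l 1)) x (Pi.single k 1) = _
    rw [fderiv_clm_apply hd (differentiableAt_const _)]
    simp
  rw [key, key, hs.eq]

theorem partialDeriv_commute (i j : Fin n) :
    Commute (partialDeriv (n := n) i) (partialDeriv j) := by
  refine AddMonoidHom.ext fun φ => ?_
  obtain ⟨f, hf, rfl⟩ := exists_eq_mk φ
  refine mk_eq_mk (hf := (hf.partialFun j).partialFun i) (hg := (hf.partialFun i).partialFun j) ?_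
  filter_upwards [eventually_analyticAt hf] with x h
  exact partialFun_comm i j h

theorem pairwise_commute_partialDeriv_pow (m : Fin n →₀ ℕ) :
    ((Finset.univ : Finset (Fin n)) : Set (Fin n)).Pairwise
      (Function.onFun Commute fun i => partialDeriv (n := n) i ^ m i) :=
  fun i _ j _ _ => (partialDeriv_commute i j).pow_pow _ _

/-- The iterated partial derivative `∂^m = ∏ i, (∂/∂t_i)^(m i)` on `R_n`. -/
noncomputable def iterDeriv (m : Fin n →₀ ℕ) : AddMonoid.End (CubeAnalytic n) :=
  Finset.univ.noncommProd (fun i => partialDeriv i ^ m i)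
    (pairwise_commute_partialDeriv_pow m)

/-- The Taylor series `∑ m, (∂^m φ)(0) / m! * t^m` of `φ` at the origin. -/
noncomputable def taylorSeries (φ : CubeAnalytic n) : MvPowerSeries (Fin n) ℝ :=
  fun m => valueAtZero (iterDeriv m φ) / ∏ i, ((m i).factorial : ℝ)

theorem iterDeriv_zero : iterDeriv (0 : Fin n →₀ ℕ) = 1 :=
  (Finset.noncommProd_eq_pow_card _ _ (pairwise_commute_partialDeriv_pow 0) 1
    fun i _ => pow_zero (partialDeriv i)).trans (one_pow _)

theorem iterDeriv_add_single (m : Fin n →₀ ℕ) (i : Fin n) (φ : CubeAnalytic n) :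
    iterDeriv (m + Finsupp.single i 1) φ = iterDeriv m (partialDeriv i φ) := by
  have : iterDeriv (n := n) (m + Finsupp.single i 1) = iterDeriv m * partialDeriv i := by
    rw [iterDeriv, iterDeriv, ← Finset.noncommProd_erase_mul _ (Finset.mem_univ i),
      ← Finset.noncommProd_erase_mul _ (Finset.mem_univ i), mul_assoc]
    congr 1
    · refine Finset.noncommProd_congr rfl (fun j hj => ?_) _
      rw [Finsupp.add_apply, Finsupp.single_eq_of_ne (Finset.ne_of_mem_erase hj), add_zero]
    · rw [Finsupp.add_apply, Finsupp.single_eq_same, pow_succ]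
  rw [this]
  rfl

theorem coeff_taylorSeries (φ : CubeAnalytic n) (m : Fin n →₀ ℕ) :
    MvPowerSeries.coeff m (taylorSeries φ) =
      valueAtZero (iterDeriv m φ) / ∏ i, ((m i).factorial : ℝ) := rfl

theorem pderiv_taylorSeries (i : Fin n) (φ : CubeAnalytic n) :
    MvPowerSeries.pderiv ℝ i (taylorSeries φ) = taylorSeries (partialDeriv i φ) := by
  ext m
  rw [MvPowerSeries.coeff_pderiv, coeff_taylorSeries, coeff_taylorSeries, iterDeriv_add_single]
  have h : ∏ j, (((m + Finsupp.single i 1 : Fin n →₀ ℕ) j).factorial : ℝ) =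
      (∏ j, ((m j).factorial : ℝ)) * (m i + 1) := by
    rw [← Finset.prod_erase_mul _ _ (Finset.mem_univ i),
      ← Finset.prod_erase_mul _ (fun j => ((m j).factorial : ℝ)) (Finset.mem_univ i), mul_assoc]
    congr 1
    · refine Finset.prod_congr rfl fun j hj => ?_
      rw [Finsupp.add_apply, Finsupp.single_eq_of_ne (Finset.ne_of_mem_erase hj), add_zero]
    · rw [Finsupp.add_apply, Finsupp.single_eq_same, Nat.factorial_succ, mul_comm]
      push_cast
      ring
  have h0 : ((m i : ℝ) + 1) ≠ 0 := by positivity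
  rw [h, div_mul_eq_mul_div, mul_div_mul_right _ _ h0]

theorem valueAtZero_add (φ ψ : CubeAnalytic n) :
    valueAtZero (φ + ψ) = valueAtZero φ + valueAtZero ψ := by
  obtain ⟨f, hf, rfl⟩ := exists_eq_mk φ
  obtain ⟨g, hg, rfl⟩ := exists_eq_mk ψ
  rfl

theorem valueAtZero_mul (φ ψ : CubeAnalytic n) :
    valueAtZero (φ * ψ) = valueAtZero φ * valueAtZero ψ := by
  obtain ⟨f, hf, rfl⟩ := exists_eq_mk φ
  obtain ⟨g, hg, rfl⟩ := exists_eq_mk ψ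
  rfl

theorem taylorSeries_add (φ ψ : CubeAnalytic n) :
    taylorSeries (φ + ψ) = taylorSeries φ + taylorSeries ψ := by
  ext m
  rw [map_add, coeff_taylorSeries, coeff_taylorSeries, coeff_taylorSeries, map_add,
    valueAtZero_add, add_div]

theorem coeff_zero_taylorSeries (φ : CubeAnalytic n) :
    MvPowerSeries.coeff 0 (taylorSeries φ) = valueAtZero φ := by
  rw [coeff_taylorSeries, iterDeriv_zero]
  simp

theorem coeff_taylorSeries_mul (k : ℕ) : ∀ (φ ψ : CubeAnalytic n) (m : Fin n →₀ ℕ),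
    m.degree = k → MvPowerSeries.coeff m (taylorSeries (φ * ψ)) =
      MvPowerSeries.coeff m (taylorSeries φ * taylorSeries ψ) := by
  induction k with
  | zero =>
    intro φ ψ m hm
    rw [(Finsupp.degree_eq_zero_iff m).1 hm, coeff_zero_taylorSeries, valueAtZero_mul,
      MvPowerSeries.coeff_zero_eq_constantCoeff_apply, map_mul,
      ← MvPowerSeries.coeff_zero_eq_constantCoeff_apply,
      ← MvPowerSeries.coeff_zero_eq_constantCoeff_apply, coeff_zero_taylorSeries,
      coeff_zero_taylorSeries]
  | succ k ih =>
    intro φ ψ m hm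
    obtain ⟨i, hi⟩ : ∃ i, m i ≠ 0 := by
      by_contra! h
      have : m = 0 := Finsupp.ext h
      simp [this] at hm
    obtain ⟨m', rfl⟩ : ∃ m', m = m' + Finsupp.single i 1 :=
      ⟨m - Finsupp.single i 1, (tsub_add_cancel_of_le
        (Finsupp.single_le_iff.2 (Nat.one_le_iff_ne_zero.2 hi))).symm⟩
    have hm' : m'.degree = k := by simpa using hm
    have h0 : ((m' i : ℝ) + 1) ≠ 0 := by positivity
    apply mul_right_cancel₀ h0
    rw [← MvPowerSeries.coeff_pderiv, ← MvPowerSeries.coeff_pderiv, pderiv_taylorSeries,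
      partialDeriv_mul, taylorSeries_add, map_add, ih _ _ _ hm', ih _ _ _ hm', Derivation.leibniz,
      pderiv_taylorSeries, pderiv_taylorSeries, map_add, smul_eq_mul, smul_eq_mul]

theorem taylorSeries_zero : taylorSeries (0 : CubeAnalytic n) = 0 := by
  simpa using taylorSeries_add (0 : CubeAnalytic n) 0

theorem taylorSeries_one : taylorSeries (1 : CubeAnalytic n) = 1 := by
  refine MvPowerSeries.pderiv.ext (fun i => ?_) ?_
  · have : partialDeriv i (1 : CubeAnalytic n) = 0 := by
      simpa using partialDeriv_mul i (1 : CubeAnalytic n) 1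
    rw [pderiv_taylorSeries, this, taylorSeries_zero, MvPowerSeries.pderiv_one]
  · rw [← MvPowerSeries.coeff_zero_eq_constantCoeff_apply, coeff_zero_taylorSeries, map_one]
    rfl

/-- The inclusion `R_n → ℝ⟦t_1, …, t_n⟧`: an analytic function goes to its Taylor series at the
origin. -/
noncomputable def taylor (n : ℕ) : CubeAnalytic n →+* MvPowerSeries (Fin n) ℝ where
  toFun := taylorSeries
  map_one' := taylorSeries_one
  map_mul' φ ψ := MvPowerSeries.ext fun m => coeff_taylorSeries_mul _ φ ψ m rfl
  map_zero' := taylorSeries_zero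
  map_add' := taylorSeries_add

end CubeAnalytic

end Analytic

/-! Write `A` for any of `ℝ[t]`, `R_n`, `ℝ⟦t⟧`. It is enough that `ℝ → A` induces an isomorphism of
Witt groups in each case: the three maps of the theorem then follow by two out of three
(`bijective_map_of_comp`). The value at the origin is a retraction `A → ℝ`, which gives injectivity.
Surjectivity splits into two statements: every space over `A` is Witt equivalent to an invertible
symmetric matrix (`IsMatrixGenerated`), and every such matrix has the class of a real one
(`MatricesDescend`). The first holds as soon as finite projective modules are stably free, since a
hyperbolic summand can be added.

For polynomials, stable freeness comes from finite free resolutions (Hilbert's syzygy theorem, one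
variable at a time). To remove a variable from a matrix, hyperbolic summands lower its degree to one
(Higman's trick). A form `H (1 + X N)` is then congruent to `H`: its invertibility makes `N`
nilpotent, so `1 + X N` has a square root that is a polynomial in `X N` and self-adjoint for `H`.

For power series and analytic functions the tool is `Matrix.wittClass_eq_of_close`, valid whenever
pointwise positive elements are squares of units: if `G'` is close to `G`, then `G' ⊥ -G` is
positive definite on one half of a basis and negative definite on the other, so its class is `n⟨1⟩ -
n⟨1⟩ = 0`. Power series are local, with the closed point as the only point, and there `G` agrees
with its constant term. For `R_n` one contracts the cube by `t ↦ s t`. By compactness of the cube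
the Witt class of `G(s t)` is locally constant in `s`, hence constant on `[0, 1]`, so `G` has the
class of `G(0)`. The same contraction, applied to idempotent matrices, shows that finite projective
`R_n`-modules are free. -/

/-! ### Witt classes of invertible symmetric matrices -/

section MatrixClass

open SymmBilinSpace Matrix

variable {A : Type u} [CommRing A]

namespace WittGroup

/-- The Witt class of a symmetric bilinear space. -/
noncomputable def cls (X : SymmBilinSpace A) : WittGroup A :=
  QuotientAddGroup.mk (GrothendieckWitt.cls X)

theorem cls_sum (X Y : SymmBilinSpace A) : cls (X.sum Y) = cls X + cls Y := by
  have : GrothendieckWitt.cls (X.sum Y) = GrothendieckWitt.cls X + GrothendieckWitt.cls Y := by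
    rw [GrothendieckWitt.cls, GrothendieckWitt.cls, GrothendieckWitt.cls, ← map_add]
    rfl
  rw [cls, this]
  rfl

theorem cls_eq_of_isometric {X Y : SymmBilinSpace A} (h : X.Isometric Y) : cls X = cls Y := by
  have : BilinClass.mk X = BilinClass.mk Y := Quotient.sound h
  rw [cls, cls, GrothendieckWitt.cls, GrothendieckWitt.cls, this]

theorem cls_eq_zero_of_isMetabolic {X : SymmBilinSpace A} (h : X.IsMetabolic) : cls X = 0 :=
  (QuotientAddGroup.eq_zero_iff _).2 (AddSubgroup.subset_closure ⟨X, h, rfl⟩)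

theorem map_cls {B : Type u} [CommRing B] (f : A →+* B) (X : SymmBilinSpace A) :
    map f (cls X) = letI := f.toAlgebra; cls (X.baseChange B) := by
  rw [cls, map, QuotientAddGroup.map_mk, GrothendieckWitt.map_cls]
  rfl

theorem exists_eq_cls_sub_cls (w : WittGroup A) : ∃ X Y : SymmBilinSpace A, w = cls X - cls Y := by
  obtain ⟨g, rfl⟩ := QuotientAddGroup.mk_surjective w
  obtain ⟨⟨x, y⟩, h⟩ := (AddLocalization.addMonoidOf (⊤ : AddSubmonoid (BilinClass A))).surj g
  obtain ⟨X, rfl⟩ := Quotient.exists_rep x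
  obtain ⟨⟨Y⟩, hY⟩ := y
  refine ⟨X, Y, ?_⟩
  have h' : g + GrothendieckWitt.cls Y = GrothendieckWitt.cls X := h
  rw [cls, cls, ← h']
  simp

end WittGroup

variable {ι κ : Type} [Fintype ι] [DecidableEq ι] [Fintype κ] [DecidableEq κ]

theorem Matrix.bijective_toBilin' {G : Matrix ι ι A} (h : IsUnit G) :
    Function.Bijective (Matrix.toBilin' G : LinearMap.BilinForm A (ι → A)) := by
  have h' := (Matrix.isUnit_iff_isUnit_det _).1 h
  constructor
  · rw [injective_iff_map_eq_zero]
    intro x hx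
    have : x ᵥ* G = 0 := by
      ext i
      have := LinearMap.congr_fun hx (Pi.single i 1)
      rw [Matrix.toBilin'_apply', dotProduct_mulVec] at this
      simpa using this
    calc x = (x ᵥ* G) ᵥ* G⁻¹ := by rw [vecMul_vecMul, mul_nonsing_inv _ h', vecMul_one]
      _ = 0 := by rw [this, zero_vecMul]
  · intro f
    refine ⟨(fun i => f (Pi.single i 1)) ᵥ* G⁻¹, ?_⟩
    refine LinearMap.pi_ext' fun i => LinearMap.ext_ring ?_
    rw [LinearMap.comp_apply, Matrix.toBilin'_apply', dotProduct_mulVec, vecMul_vecMul,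
      nonsing_inv_mul _ h', vecMul_one]
    simp

/-- The symmetric bilinear space with Gram matrix `G` on a free module. -/
noncomputable def SymmBilinSpace.ofMatrix (G : Matrix ι ι A) (hs : G.IsSymm) (hu : IsUnit G) :
    SymmBilinSpace A where
  carrier := ι → A
  form := Matrix.toBilin' G
  symm := Matrix.isSymm_toBilin'_iff_isSymm.2 hs
  unimodular := Matrix.bijective_toBilin' hu

open Classical in
/-- The Witt class of an invertible symmetric matrix (zero for all other matrices). -/
noncomputable def Matrix.wittClass (G : Matrix ι ι A) : WittGroup A :=
  if h : G.IsSymm ∧ IsUnit G then WittGroup.cls (SymmBilinSpace.ofMatrix G h.1 h.2) else 0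

namespace Matrix

theorem wittClass_eq {G : Matrix ι ι A} (hs : G.IsSymm) (hu : IsUnit G) :
    G.wittClass = WittGroup.cls (SymmBilinSpace.ofMatrix G hs hu) := dif_pos ⟨hs, hu⟩

omit [DecidableEq ι] [Fintype κ] [DecidableEq κ] in
theorem IsSymm.congruence {G : Matrix ι ι A} (hs : G.IsSymm) (V : Matrix ι κ A) :
    (Vᵀ * G * V).IsSymm := by
  rw [IsSymm, transpose_mul, transpose_mul, transpose_transpose, hs.eq, Matrix.mul_assoc]

/-- The index types may differ, so `V` comes with a two-sided inverse `W`. Relabelling a basis is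
then the case of a permutation matrix. -/
theorem wittClass_congruence {G : Matrix ι ι A} (hs : G.IsSymm) (hu : IsUnit G) {V : Matrix ι κ A}
    {W : Matrix κ ι A} (h : V * W = 1) (h' : W * V = 1) :
    (Vᵀ * G * V).wittClass = G.wittClass := by
  have hd := (isUnit_iff_isUnit_det G).1 hu
  have hu' : IsUnit (Vᵀ * G * V) := by
    refine (Units.mkOfMulEqOne _ (W * G⁻¹ * Wᵀ) ?_).isUnit
    calc Vᵀ * G * V * (W * G⁻¹ * Wᵀ) = Vᵀ * (G * (V * W) * G⁻¹) * Wᵀ := by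
          simp only [Matrix.mul_assoc]
      _ = (W * V)ᵀ := by
          rw [h, Matrix.mul_one, mul_nonsing_inv _ hd, Matrix.mul_one, transpose_mul]
      _ = 1 := by rw [h', transpose_one]
  rw [wittClass_eq (hs.congruence V) hu', wittClass_eq hs hu]
  refine WittGroup.cls_eq_of_isometric ⟨{ Matrix.toLin'OfInv h' h with map_app' := ?_ }⟩
  intro x y
  change Matrix.toBilin' G (Matrix.toLin' V x) (Matrix.toLin' V y) =
    Matrix.toBilin' (Vᵀ * G * V) x y
  rw [← Matrix.toBilin'_comp]
  rfl

theorem wittClass_submatrix_equiv {G : Matrix ι ι A} (hs : G.IsSymm) (hu : IsUnit G) (e : κ ≃ ι) :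
    (G.submatrix e e).wittClass = G.wittClass := by
  rw [← wittClass_congruence hs hu (V := (1 : Matrix ι ι A).submatrix id e)
    (W := (1 : Matrix ι ι A).submatrix e id)]
  · congr 1
    simp [transpose_submatrix]
    ext i j
    simp [Matrix.mul_apply, Matrix.one_apply]
  · rw [submatrix_mul_equiv]
    simp
  · ext i j
    simp [Matrix.mul_apply, Matrix.one_apply]

theorem isUnit_fromBlocks_diagonal {G : Matrix ι ι A} {H : Matrix κ κ A} (hG : IsUnit G)
    (hH : IsUnit H) : IsUnit (fromBlocks G 0 0 H) :=
  isUnit_fromBlocks_zero₂₁.2 ⟨hG, hH⟩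

theorem toBilin'_fromBlocks (G : Matrix ι ι A) (B : Matrix ι κ A) (C : Matrix κ ι A)
    (H : Matrix κ κ A) (x y : ι ⊕ κ → A) : toBilin' (fromBlocks G B C H) x y =
      (x ∘ Sum.inl) ⬝ᵥ (G *ᵥ (y ∘ Sum.inl)) + (x ∘ Sum.inl) ⬝ᵥ (B *ᵥ (y ∘ Sum.inr)) +
      ((x ∘ Sum.inr) ⬝ᵥ (C *ᵥ (y ∘ Sum.inl)) + (x ∘ Sum.inr) ⬝ᵥ (H *ᵥ (y ∘ Sum.inr))) := by
  rw [toBilin'_apply', fromBlocks_mulVec]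
  conv_lhs => rw [← Sum.elim_comp_inl_inr x]
  rw [sumElim_dotProduct_sumElim, dotProduct_add, dotProduct_add]

theorem wittClass_fromBlocks_diagonal {G : Matrix ι ι A} {H : Matrix κ κ A} (hGs : G.IsSymm)
    (hG : IsUnit G) (hHs : H.IsSymm) (hH : IsUnit H) :
    (fromBlocks G 0 0 H).wittClass = G.wittClass + H.wittClass := by
  have hs : (fromBlocks G 0 0 H).IsSymm := hGs.fromBlocks (transpose_zero) hHs
  rw [wittClass_eq hs (isUnit_fromBlocks_diagonal hG hH), wittClass_eq hGs hG,
    wittClass_eq hHs hH, ← WittGroup.cls_sum]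
  have key : ∀ x y : ι ⊕ κ → A, sumForm (toBilin' G) (toBilin' H)
      (x ∘ Sum.inl, x ∘ Sum.inr) (y ∘ Sum.inl, y ∘ Sum.inr) =
      toBilin' (fromBlocks G 0 0 H) x y := by
    intro x y
    rw [sumForm_apply, toBilin'_fromBlocks]
    simp [toBilin'_apply']
  exact WittGroup.cls_eq_of_isometric
    ⟨{ LinearEquiv.sumArrowLequivProdArrow ι κ A A with map_app' := key }⟩

theorem isUnit_fromBlocks_metabolic {B : Matrix ι ι A} (hB : IsUnit B) (C : Matrix ι ι A) :
    IsUnit (fromBlocks 0 B Bᵀ C) := by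
  have h := (isUnit_iff_isUnit_det B).1 hB
  have h' : IsUnit Bᵀ.det := by rwa [det_transpose]
  refine IsUnit.of_mul_eq_one (fromBlocks (-Bᵀ⁻¹ * C * B⁻¹) Bᵀ⁻¹ B⁻¹ 0) ?_
  rw [fromBlocks_multiply]
  simp only [Matrix.zero_mul, mul_nonsing_inv _ h, mul_nonsing_inv _ h', Matrix.mul_zero,
    add_zero, neg_mul, mul_neg, ← Matrix.mul_assoc, Matrix.one_mul, neg_add_cancel]
  rw [neg_zero, zero_add, fromBlocks_one]

/-- The Lagrangian consists of the vectors supported on the first copy of `ι`. Orthogonality to it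
says that `B` kills the second component, which vanishes because `B` is invertible. -/
theorem exists_lagrangian {B : Matrix ι ι A} (hB : IsUnit B) (C : Matrix ι ι A) :
    ∃ L : Submodule A (ι ⊕ ι → A), (∃ M : Submodule A (ι ⊕ ι → A), IsCompl L M) ∧
      (toBilin' (fromBlocks 0 B Bᵀ C)).orthogonal L = L := by
  have h := (isUnit_iff_isUnit_det B).1 hB
  refine ⟨LinearMap.ker (LinearMap.funLeft A A Sum.inr),
    ⟨LinearMap.ker (LinearMap.funLeft A A Sum.inl), ?_⟩, ?_⟩
  · constructor
    · rw [Submodule.disjoint_def]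
      intro x hx hx'
      rw [LinearMap.mem_ker] at hx hx'
      funext i
      rcases i with i | i
      · exact congrFun hx' i
      · exact congrFun hx i
    · rw [codisjoint_iff, eq_top_iff]
      rintro x -
      refine Submodule.mem_sup.2 ⟨Sum.elim (x ∘ Sum.inl) 0, ?_, Sum.elim 0 (x ∘ Sum.inr), ?_, ?_⟩
      · rw [LinearMap.mem_ker]
        rfl
      · rw [LinearMap.mem_ker]
        rfl
      · funext i
        rcases i with i | i <;> simp
  · ext y
    have e : ∀ z : ι ⊕ ι → A, z ∈ LinearMap.ker (LinearMap.funLeft A A Sum.inr) ↔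
      z ∘ (Sum.inr : ι → ι ⊕ ι) = 0 := fun z => Iff.rfl
    rw [LinearMap.BilinForm.mem_orthogonal_iff, e]
    constructor
    · intro hy
      have : B *ᵥ (y ∘ Sum.inr) = 0 := by
        funext i
        have := hy (Sum.elim (Pi.single i 1) 0) ((e _).2 rfl)
        rw [toBilin'_fromBlocks, Sum.elim_comp_inl, Sum.elim_comp_inr] at this
        simpa using this
      calc y ∘ Sum.inr = B⁻¹ *ᵥ (B *ᵥ (y ∘ Sum.inr)) := by
            rw [mulVec_mulVec, nonsing_inv_mul _ h, one_mulVec]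
        _ = 0 := by rw [this, mulVec_zero]
    · intro hy x hx
      rw [toBilin'_fromBlocks, (e x).1 hx, hy]
      simp

theorem wittClass_metabolic {B C : Matrix ι ι A} (hB : IsUnit B) (hC : C.IsSymm) :
    (fromBlocks 0 B Bᵀ C).wittClass = 0 := by
  have hs : (fromBlocks 0 B Bᵀ C).IsSymm :=
    IsSymm.fromBlocks (transpose_zero) rfl hC
  rw [wittClass_eq hs (isUnit_fromBlocks_metabolic hB C)]
  exact WittGroup.cls_eq_zero_of_isMetabolic (exists_lagrangian hB C)

/-- In `G ⊥ -G` the diagonal is totally isotropic. In the basis formed by the diagonal vectors and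
the first summand the Gram matrix is metabolic. -/
theorem wittClass_neg {G : Matrix ι ι A} (hs : G.IsSymm) (hu : IsUnit G) :
    (-G).wittClass = -G.wittClass := by
  rw [eq_neg_iff_add_eq_zero, add_comm, ← wittClass_fromBlocks_diagonal hs hu hs.neg hu.neg,
    ← wittClass_congruence (IsSymm.fromBlocks hs transpose_zero hs.neg)
      (isUnit_fromBlocks_diagonal hu hu.neg) 
      (V := (fromBlocks 1 1 1 0 : Matrix (ι ⊕ ι) (ι ⊕ ι) A))
      (W := (fromBlocks 0 1 1 (-1) : Matrix (ι ⊕ ι) (ι ⊕ ι) A))]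
  · have : ((fromBlocks 1 1 1 0)ᵀ * fromBlocks G 0 0 (-G) * fromBlocks 1 1 1 0 :
        Matrix (ι ⊕ ι) (ι ⊕ ι) A) = fromBlocks 0 G Gᵀ G := by
      rw [fromBlocks_transpose, fromBlocks_multiply, fromBlocks_multiply, hs.eq]
      simp
    rw [this, wittClass_metabolic hu hs]
  · rw [fromBlocks_multiply, ← fromBlocks_one]
    simp
  · rw [fromBlocks_multiply, ← fromBlocks_one]
    simp

theorem isUnit_map {B : Type*} [CommRing B] {G : Matrix ι ι A} (hu : IsUnit G) (f : A →+* B) :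
    IsUnit (G.map f) := hu.map f.mapMatrix

theorem map_wittClass {B : Type u} [CommRing B] (f : A →+* B) {G : Matrix ι ι A}
    (hs : G.IsSymm) (hu : IsUnit G) : WittGroup.map f G.wittClass = (G.map f).wittClass := by
  rw [wittClass_eq hs hu, wittClass_eq (hs.map f) (isUnit_map hu f), WittGroup.map_cls]
  let _ := f.toAlgebra
  refine WittGroup.cls_eq_of_isometric
    ⟨{ TensorProduct.piScalarRight A B B ι with map_app' := ?_ }⟩
  change ∀ z w : B ⊗[A] (ι → A), toBilin' (G.map f) (TensorProduct.piScalarRight A B B ι z)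
    (TensorProduct.piScalarRight A B B ι w) = (toBilin' G).baseChange B z w
  intro z w
  induction z with
  | zero => simp
  | add z z' hz hz' => simp only [map_add, LinearMap.add_apply, hz, hz']
  | tmul b p =>
    induction w with
    | zero => simp
    | add w w' hw hw' => simp only [map_add, hw, hw']
    | tmul c q =>
      rw [TensorProduct.piScalarRight_apply, TensorProduct.piScalarRight_apply,
        LinearMap.BilinForm.baseChange_tmul, TensorProduct.piScalarRightHom_tmul,
        TensorProduct.piScalarRightHom_tmul, toBilin'_apply, toBilin'_apply, Algebra.smul_def]
      simp only [map_apply, map_sum, map_mul, Finset.sum_mul, Algebra.smul_def]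
      refine Finset.sum_congr rfl fun i _ => Finset.sum_congr rfl fun j _ => ?_
      change algebraMap A B (p i) * b * algebraMap A B (G i j) * (algebraMap A B (q j) * c) = _
      ring

end Matrix

namespace SymmBilinSpace

/-- Preimages of the coordinate functionals are the rows of a left inverse of `G`. -/
theorem _root_.Matrix.isUnit_of_surjective_toBilin' {G : Matrix ι ι A}
    (h : Function.Surjective (Matrix.toBilin' G : LinearMap.BilinForm A (ι → A))) : IsUnit G := by
  choose x hx using fun i => h (LinearMap.proj i)
  refine IsUnit.of_mul_eq_one_right (Matrix.of x) ?_
  ext i j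
  have := LinearMap.congr_fun (hx i) (Pi.single j 1)
  rw [Matrix.toBilin'_apply', dotProduct_mulVec] at this
  simpa [Matrix.mul_apply, vecMul, dotProduct, Matrix.one_apply, Pi.single_apply] using this

/-- A space on a free module is given by its Gram matrix. -/
theorem exists_isometric_ofMatrix (X : SymmBilinSpace A) {m : ℕ}
    (b : Module.Basis (Fin m) A X.carrier) : ∃ (G : Matrix (Fin m) (Fin m) A) (hs : G.IsSymm)
      (hu : IsUnit G), X.Isometric (ofMatrix G hs hu) := by
  set G := LinearMap.BilinForm.toMatrix b X.form with hG
  have hs : G.IsSymm := (LinearMap.BilinForm.isSymm_toMatrix_iff_isSymm b).2 X.symm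
  have key : ∀ x y : X.carrier, toBilin' G (b.equivFun x) (b.equivFun y) = X.form x y := by
    intro x y
    rw [hG, LinearMap.BilinForm.apply_eq_dotProduct_toMatrix_mulVec b X.form x y,
      toBilin'_apply']
    rfl
  have hu : IsUnit G := by
    refine Matrix.isUnit_of_surjective_toBilin' fun f => ?_
    obtain ⟨x, hx⟩ := X.unimodular.2 (f ∘ₗ b.equivFun.toLinearMap)
    refine ⟨b.equivFun x, LinearMap.ext fun y => ?_⟩
    obtain ⟨y, rfl⟩ := b.equivFun.surjective y
    rw [key, hx]
    rfl
  exact ⟨G, hs, hu, ⟨{ b.equivFun with map_app' := key }⟩⟩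

/-- The hyperbolic space on `A^m ⊕ A^m` has class zero, and adding it to a space on `P` with `P ⊕
A^m ≃ A^k` produces a space on the free module `A^(k + m)`. -/
theorem exists_cls_eq_wittClass_of_equiv (X : SymmBilinSpace A) {m k : ℕ}
    (e : (X.carrier × (Fin m → A)) ≃ₗ[A] (Fin k → A)) :
    ∃ (r : ℕ) (G : Matrix (Fin r) (Fin r) A), G.IsSymm ∧ IsUnit G ∧
      WittGroup.cls X = G.wittClass := by
  have hs : (fromBlocks 0 1 1ᵀ 0 : Matrix (Fin m ⊕ Fin m) (Fin m ⊕ Fin m) A).IsSymm :=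
    IsSymm.fromBlocks transpose_zero rfl isSymm_zero
  have hu : IsUnit (fromBlocks 0 1 1ᵀ 0 : Matrix (Fin m ⊕ Fin m) (Fin m ⊕ Fin m) A) :=
    isUnit_fromBlocks_metabolic isUnit_one 0
  have e' : (X.sum (ofMatrix _ hs hu)).carrier ≃ₗ[A] (Fin (k + m) → A) :=
    ((LinearEquiv.refl A X.carrier).prodCongr
      (LinearEquiv.sumArrowLequivProdArrow (Fin m) (Fin m) A A)).trans <|
    (LinearEquiv.prodAssoc A X.carrier (Fin m → A) (Fin m → A)).symm.trans <|
    (e.prodCongr (LinearEquiv.refl A _)).trans <|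
    (LinearEquiv.sumArrowLequivProdArrow (Fin k) (Fin m) A A).symm.trans <|
    LinearEquiv.funCongrLeft A A finSumFinEquiv.symm
  obtain ⟨G, hGs, hGu, h⟩ := exists_isometric_ofMatrix _ (Module.Basis.ofEquivFun e')
  refine ⟨_, G, hGs, hGu, ?_⟩
  rw [wittClass_eq hGs hGu, ← WittGroup.cls_eq_of_isometric h, WittGroup.cls_sum,
    ← wittClass_eq hs hu, wittClass_metabolic isUnit_one isSymm_zero, add_zero]

end SymmBilinSpace

/-- Every Witt class of `A` is the class of an invertible symmetric matrix. -/
def WittGroup.IsMatrixGenerated (A : Type u) [CommRing A] : Prop :=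
  ∀ X : SymmBilinSpace A, ∃ (r : ℕ) (G : Matrix (Fin r) (Fin r) A), G.IsSymm ∧ IsUnit G ∧
      WittGroup.cls X = G.wittClass

/-- A difference of two matrix classes is again one, namely that of `G ⊥ -H`. -/
theorem WittGroup.IsMatrixGenerated.exists_eq_wittClass
    (h : WittGroup.IsMatrixGenerated A) (w : WittGroup A) :
    ∃ (r : ℕ) (G : Matrix (Fin r) (Fin r) A), G.IsSymm ∧ IsUnit G ∧ w = G.wittClass := by
  obtain ⟨X, Y, rfl⟩ := WittGroup.exists_eq_cls_sub_cls w
  obtain ⟨r, G, hGs, hGu, hG⟩ := h X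
  obtain ⟨s, H, hHs, hHu, hH⟩ := h Y
  have hu := isUnit_fromBlocks_diagonal hGu hHu.neg
  have hs : (fromBlocks G 0 0 (-H)).IsSymm := IsSymm.fromBlocks hGs transpose_zero hHs.neg
  refine ⟨r + s, (fromBlocks G 0 0 (-H)).submatrix finSumFinEquiv.symm finSumFinEquiv.symm,
    hs.submatrix _, ?_, ?_⟩
  · rwa [isUnit_submatrix_equiv]
  · rw [wittClass_submatrix_equiv hs hu, wittClass_fromBlocks_diagonal hGs hGu hHs.neg hHu.neg,
      wittClass_neg hHs hHu, hG, hH, sub_eq_add_neg]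

/-- The classes of matrices over `B` are classes of matrices with entries in `A`. -/
def WittGroup.MatricesDescend {A B : Type u} [CommRing A] [CommRing B] (f : A →+* B) : Prop :=
  ∀ (r : ℕ) (G : Matrix (Fin r) (Fin r) B), G.IsSymm → IsUnit G →
    ∃ (s : ℕ) (H : Matrix (Fin s) (Fin s) A), H.IsSymm ∧ IsUnit H ∧
      G.wittClass = (H.map f).wittClass

theorem WittGroup.MatricesDescend.comp {A B C : Type u} [CommRing A] [CommRing B] [CommRing C]
    {f : A →+* B} {g : B →+* C} (hg : MatricesDescend g) (hf : MatricesDescend f) :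
    MatricesDescend (g.comp f) := by
  intro r G hs hu
  obtain ⟨s, H, hHs, hHu, hH⟩ := hg r G hs hu
  obtain ⟨t, K, hKs, hKu, hK⟩ := hf s H hHs hHu
  refine ⟨t, K, hKs, hKu, ?_⟩
  rw [hH, ← map_wittClass g hHs hHu, hK, map_wittClass g (hKs.map f) (isUnit_map hKu f),
    Matrix.map_map, RingHom.coe_comp]

theorem WittGroup.matricesDescend_of_surjective_of_leftInverse {A B : Type u} [CommRing A]
    [CommRing B] {f : A →+* B} {g : B →+* A} (h : f.comp g = RingHom.id B) :
    MatricesDescend f := fun r G hs hu =>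
  ⟨r, G.map g, hs.map g, isUnit_map hu g, by
    rw [Matrix.map_map, ← RingHom.coe_comp, h]
    simp⟩

theorem WittGroup.surjective_map {A B : Type u} [CommRing A] [CommRing B] {f : A →+* B}
    (hB : IsMatrixGenerated B) (hf : MatricesDescend f) : Function.Surjective (map f) := by
  intro w
  obtain ⟨r, G, hGs, hGu, rfl⟩ := hB.exists_eq_wittClass w
  obtain ⟨s, H, hHs, hHu, hH⟩ := hf r G hGs hGu
  exact ⟨H.wittClass, by rw [map_wittClass f hHs hHu, hH]⟩

/-- On matrices, extension of scalars is entrywise application. Assuming matrix generation reduces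
functoriality to this and avoids iterated tensor products. -/
theorem WittGroup.map_comp {A B C : Type u} [CommRing A] [CommRing B] [CommRing C]
    (hA : IsMatrixGenerated A) (g : B →+* C) (f : A →+* B) (w : WittGroup A) :
    map (g.comp f) w = map g (map f w) := by
  obtain ⟨r, G, hs, hu, rfl⟩ := hA.exists_eq_wittClass w
  rw [map_wittClass _ hs hu, map_wittClass _ hs hu, map_wittClass _ (hs.map f) (isUnit_map hu f),
    Matrix.map_map, RingHom.coe_comp]

theorem WittGroup.map_id {A : Type u} [CommRing A] (hA : IsMatrixGenerated A) (w : WittGroup A) :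
    map (RingHom.id A) w = w := by
  obtain ⟨r, G, hs, hu, rfl⟩ := hA.exists_eq_wittClass w
  rw [map_wittClass _ hs hu]
  simp

theorem WittGroup.bijective_map_of_retraction {A B : Type u} [CommRing A] [CommRing B]
    {f : A →+* B} {g : B →+* A} (h : g.comp f = RingHom.id A) (hA : IsMatrixGenerated A)
    (hB : IsMatrixGenerated B) (hf : MatricesDescend f) : Function.Bijective (map f) := by
  refine ⟨Function.LeftInverse.injective (g := map g) fun w => ?_, surjective_map hB hf⟩
  rw [← map_comp hA, h, map_id hA]

end MatrixClass

/-! ### Finite free resolutions and stable freeness -/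

section FreeResolutions

/-- `M` has a resolution of length at most `n` by finite free modules. -/
def HasFreeResolutionLE (R : Type u) [CommRing R] :
    ℕ → (M : Type u) → [AddCommGroup M] → [Module R M] → Prop
  | 0, M, _, _ => Module.Finite R M ∧ Module.Free R M
  | n + 1, M, _, _ => ∃ (F : Type u) (_ : AddCommGroup F) (_ : Module R F)
      (_ : Module.Finite R F) (_ : Module.Free R F) (f : F →ₗ[R] M),
      Function.Surjective f ∧ HasFreeResolutionLE R n (LinearMap.ker f)

namespace HasFreeResolutionLE

variable {R : Type u} [CommRing R] {M N : Type u} [AddCommGroup M] [Module R M]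
  [AddCommGroup N] [Module R N]

theorem of_equiv {n : ℕ} (e : M ≃ₗ[R] N) (h : HasFreeResolutionLE R n M) :
    HasFreeResolutionLE R n N := by
  cases n with
  | zero =>
    obtain ⟨_, _⟩ := h
    exact ⟨Module.Finite.equiv e, Module.Free.of_equiv e⟩
  | succ n =>
    obtain ⟨F, _, _, _, _, f, hf, hk⟩ := h
    refine ⟨F, _, _, ‹_›, ‹_›, e.toLinearMap ∘ₗ f, e.surjective.comp hf, ?_⟩
    rwa [LinearEquiv.ker_comp]

theorem of_free (n : ℕ) [Module.Finite R M] [Module.Free R M] : HasFreeResolutionLE R n M := by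
  induction n generalizing M with
  | zero => exact ⟨‹_›, ‹_›⟩
  | succ n ih =>
    refine ⟨M, _, _, ‹_›, ‹_›, LinearMap.id, Function.surjective_id, ?_⟩
    rw [LinearMap.ker_id]
    exact ih

theorem succ {n : ℕ} (h : HasFreeResolutionLE R n M) : HasFreeResolutionLE R (n + 1) M := by
  induction n generalizing M with
  | zero =>
    obtain ⟨_, _⟩ := h
    exact of_free 1
  | succ n ih =>
    obtain ⟨F, _, _, _, _, f, hf, hk⟩ := h
    exact ⟨F, _, _, ‹_›, ‹_›, f, hf, ih hk⟩

theorem mono {n m : ℕ} (hnm : n ≤ m) (h : HasFreeResolutionLE R n M) :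
    HasFreeResolutionLE R m M := by
  induction m, hnm using Nat.le_induction with
  | base => exact h
  | succ m _ ih => exact ih.succ

/-- An extension of modules with finite free resolutions has one. -/
theorem of_extension {n : ℕ} (f : M →ₗ[R] N) (hf : Function.Surjective f)
    (hk : HasFreeResolutionLE R n (LinearMap.ker f)) (hN : HasFreeResolutionLE R n N) :
    HasFreeResolutionLE R n M := by
  induction n generalizing M N with
  | zero =>
    obtain ⟨_, _⟩ := hk
    obtain ⟨_, _⟩ := hN
    obtain ⟨s, hs⟩ := Module.projective_lifting_property f LinearMap.id hf
    have e : (LinearMap.ker f × N) ≃ₗ[R] M := by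
      refine LinearEquiv.ofBijective ((LinearMap.ker f).subtype.coprod s) ⟨?_, fun x => ?_⟩
      · rw [injective_iff_map_eq_zero]
        rintro ⟨⟨x, hx⟩, y⟩ h
        have h' : x + s y = 0 := h
        have hy : y = 0 := by
          have := congrArg f h'
          rw [map_add, LinearMap.mem_ker.1 hx, zero_add, map_zero] at this
          exact (LinearMap.congr_fun hs y).symm.trans this
        subst hy
        rw [map_zero, add_zero] at h'
        subst h'
        rfl
      · refine ⟨(⟨x - s (f x), ?_⟩, f x), sub_add_cancel x _⟩
        rw [LinearMap.mem_ker, map_sub, sub_eq_zero]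
        exact (LinearMap.congr_fun hs (f x)).symm
    exact ⟨Module.Finite.equiv e, Module.Free.of_equiv e⟩
  | succ n ih =>
    obtain ⟨F, _, _, _, _, p, hp, hpk⟩ := hk
    obtain ⟨G, _, _, _, _, q, hq, hqk⟩ := hN
    -- Horseshoe lemma: a lift `s` of `q` through `f` makes `F × G` a free cover of `M`. Its kernel
    -- is an extension of `ker q` by `ker p`, to which the induction hypothesis applies.
    obtain ⟨s, hs⟩ := Module.projective_lifting_property f q hf
    have hs' : ∀ y, f (s y) = q y := fun y => LinearMap.congr_fun hs y
    set g : F × G →ₗ[R] M := ((LinearMap.ker f).subtype ∘ₗ p).coprod s with hg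
    have hg' : ∀ z, g z = (p z.1 : M) + s z.2 := fun z => rfl
    have hfp : ∀ x, f (p x : M) = 0 := fun x => LinearMap.mem_ker.1 (p x).2
    have hfg : ∀ z, f (g z) = q z.2 := fun z => by rw [hg', map_add, hfp, zero_add, hs']
    refine ⟨F × G, _, _, inferInstance, inferInstance, g, fun x => ?_, ?_⟩
    · obtain ⟨y, hy⟩ := hq (f x)
      obtain ⟨z, hz⟩ := hp ⟨x - s y, by rw [LinearMap.mem_ker, map_sub, hs', hy, sub_self]⟩
      exact ⟨(z, y), by rw [hg', hz, sub_add_cancel]⟩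
    · have hmem : ∀ z : LinearMap.ker g, (LinearMap.snd R F G) z ∈ LinearMap.ker q := by
        rintro ⟨z, hz⟩
        rw [LinearMap.mem_ker] at hz ⊢
        change q z.2 = 0
        rw [← hfg, hz, map_zero]
      set π : LinearMap.ker g →ₗ[R] LinearMap.ker q :=
        (LinearMap.snd R F G ∘ₗ (LinearMap.ker g).subtype).codRestrict (LinearMap.ker q) hmem
      refine ih π ?_ ?_ hqk
      · rintro ⟨y, hy⟩
        obtain ⟨z, hz⟩ := hp ⟨- s y, by
          rw [LinearMap.mem_ker, map_neg, hs', LinearMap.mem_ker.1 hy, neg_zero]⟩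
        exact ⟨⟨(z, y), by rw [LinearMap.mem_ker, hg', hz, neg_add_cancel]⟩, rfl⟩
      · refine of_equiv (LinearEquiv.ofBijective (LinearMap.codRestrict (LinearMap.ker π)
          (LinearMap.codRestrict (LinearMap.ker g) (LinearMap.inl R F G ∘ₗ
            (LinearMap.ker p).subtype) ?_) ?_) ⟨?_, ?_⟩) hpk
        · rintro ⟨x, hx⟩
          rw [LinearMap.mem_ker, hg']
          change (p x : M) + s 0 = 0
          rw [LinearMap.mem_ker.1 hx, map_zero, add_zero]
          rfl
        · intro x
          rfl
        · intro x y h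
          have : ((x : F), (0 : G)) = ((y : F), 0) := congrArg (fun z => z.1.1) h
          exact Subtype.ext (congrArg Prod.fst this)
        · rintro ⟨⟨⟨x, y⟩, hz⟩, hy⟩
          have hy' : y = 0 := congrArg Subtype.val hy
          subst hy'
          refine ⟨⟨x, ?_⟩, rfl⟩
          rw [LinearMap.mem_ker, hg'] at hz
          rw [LinearMap.mem_ker]
          apply Subtype.ext
          simpa using hz

/-- A free cover `F → M` composed with `f` covers `N`, and the kernel of the composite is an
extension of `ker f` by `ker (F → M)`. -/
theorem of_surjective {n : ℕ} (f : M →ₗ[R] N) (hf : Function.Surjective f)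
    (hk : HasFreeResolutionLE R n (LinearMap.ker f)) (hM : HasFreeResolutionLE R n M) :
    HasFreeResolutionLE R (n + 1) N := by
  -- Passing to length `n + 1` yields a cover of `M` even for `n = 0`, where `hM` only says that `M`
  -- is finite free.
  obtain ⟨F, _, _, _, _, g, hg, hgk⟩ := hM.succ
  refine ⟨F, _, _, ‹_›, ‹_›, f ∘ₗ g, hf.comp hg, ?_⟩
  have hmem : ∀ z : LinearMap.ker (f ∘ₗ g), g z ∈ LinearMap.ker f := fun z => z.2
  refine of_extension ((g ∘ₗ (LinearMap.ker (f ∘ₗ g)).subtype).codRestrict (LinearMap.ker f) hmem)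
    ?_ ?_ hk
  · rintro ⟨y, hy⟩
    obtain ⟨x, rfl⟩ := hg y
    exact ⟨⟨x, hy⟩, rfl⟩
  · refine of_equiv (LinearEquiv.ofBijective (LinearMap.codRestrict _
      (LinearMap.codRestrict (LinearMap.ker (f ∘ₗ g)) (LinearMap.ker g).subtype ?_) ?_)
        ⟨?_, ?_⟩) hgk
    · intro x
      rw [LinearMap.mem_ker, LinearMap.comp_apply, Submodule.subtype_apply,
        LinearMap.mem_ker.1 x.2, map_zero]
    · intro x
      exact Subtype.ext (LinearMap.mem_ker.1 x.2)
    · intro x y h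
      exact Subtype.ext (congrArg (fun z => z.1.1) h)
    · rintro ⟨⟨x, hx⟩, hx'⟩
      exact ⟨⟨x, congrArg Subtype.val hx'⟩, rfl⟩

/-- Flatness identifies the kernel of the extended cover with the extension of the kernel. -/
theorem baseChange (S : Type u) [CommRing S] [Algebra R S] [Module.Flat R S] {n : ℕ}
    (h : HasFreeResolutionLE R n M) : HasFreeResolutionLE S n (S ⊗[R] M) := by
  induction n generalizing M with
  | zero =>
    obtain ⟨_, _⟩ := h
    exact ⟨inferInstance, inferInstance⟩
  | succ n ih =>
    obtain ⟨F, _, _, _, _, f, hf, hk⟩ := h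
    refine ⟨S ⊗[R] F, _, _, inferInstance, inferInstance,
      TensorProduct.AlgebraTensorModule.lTensor S S f, LinearMap.lTensor_surjective S hf, ?_⟩
    exact of_equiv (LinearMap.tensorKerEquiv S S f) (ih hk)

/-- A projective module with a finite free resolution is stably free. -/
theorem exists_stably_free {n : ℕ} [Module.Projective R M] (h : HasFreeResolutionLE R n M) :
    ∃ (F : Type u) (_ : AddCommGroup F) (_ : Module R F) (_ : Module.Finite R F)
      (_ : Module.Free R F), Module.Finite R (M × F) ∧ Module.Free R (M × F) := by
  induction n generalizing M with
  | zero =>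
    obtain ⟨_, _⟩ := h
    exact ⟨PUnit, _, _, inferInstance, inferInstance, inferInstance, inferInstance⟩
  | succ n ih =>
    obtain ⟨F, _, _, _, _, f, hf, hk⟩ := h
    obtain ⟨s, hs⟩ := Module.projective_lifting_property f LinearMap.id hf
    have hs' : ∀ y, f (s y) = y := fun y => LinearMap.congr_fun hs y
    have hmem : ∀ x, x - s (f x) ∈ LinearMap.ker f := fun x => by
      rw [LinearMap.mem_ker, map_sub, hs', sub_self]
    let e : (M × LinearMap.ker f) ≃ₗ[R] F := by
      refine LinearEquiv.ofLinearMap (s.coprod (LinearMap.ker f).subtype)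
        (f.prod ((LinearMap.id - s ∘ₗ f).codRestrict _ hmem)) ?_ ?_
      · ext x
        change s (f x) + (x - s (f x)) = x
        abel
      · refine LinearMap.ext ?_
        rintro ⟨x, y, hy⟩
        have h1 : f (s x + y) = x := by rw [map_add, hs', LinearMap.mem_ker.1 hy, add_zero]
        refine Prod.ext h1 (Subtype.ext ?_)
        change s x + y - s (f (s x + y)) = y
        rw [h1, add_sub_cancel_left]
    have : Module.Projective R (LinearMap.ker f) :=
      Module.Projective.of_split (LinearMap.ker f).subtype
        ((LinearMap.id - s ∘ₗ f).codRestrict _ hmem) (by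
          ext ⟨x, hx⟩
          change x - s (f x) = x
          rw [LinearMap.mem_ker.1 hx, map_zero, sub_zero])
    obtain ⟨G, _, _, _, _, h1, h2⟩ := ih hk
    -- The cover splits as `F ≃ M × ker f`, and `ker f × G` is free by induction. This module is the
    -- free complement of `M`, with total space `F × G`.
    let e' : (F × G) ≃ₗ[R] (M × (LinearMap.ker f × G)) :=
      (e.symm.prodCongr (LinearEquiv.refl R G)).trans (LinearEquiv.prodAssoc R M _ G)
    exact ⟨_, _, _, h1, h2, Module.Finite.equiv e', Module.Free.of_equiv e'⟩

end HasFreeResolutionLE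

/-- Every finite `R`-module has a finite free resolution. -/
def HasFiniteFreeResolutions (R : Type u) [CommRing R] : Prop :=
  ∀ (M : Type u) [AddCommGroup M] [Module R M] [Module.Finite R M],
    ∃ n, HasFreeResolutionLE R n M

theorem HasFiniteFreeResolutions.of_field (k : Type u) [Field k] : HasFiniteFreeResolutions k :=
  fun _ _ _ _ => ⟨0, ‹_›, inferInstance⟩

/-- An `S`-module is the extension of scalars of its own restriction along the equivalence, and an
equivalence is flat. -/
theorem HasFiniteFreeResolutions.of_ringEquiv {R S : Type u} [CommRing R] [CommRing S]
    (e : R ≃+* S) (h : HasFiniteFreeResolutions R) : HasFiniteFreeResolutions S := by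
  intro M _ _ _
  let _ : Algebra R S := e.toRingHom.toAlgebra
  let _ : Module R M := Module.compHom M e.toRingHom
  have : IsScalarTower R S M := ⟨fun r s m => mul_smul (e r) s m⟩
  have hsurj : Function.Surjective (algebraMap R S) := e.surjective
  have : Module.Finite R S := Module.Finite.of_surjective (Algebra.linearMap R S) hsurj
  have : Module.Finite R M := Module.Finite.trans S M
  have : Module.Flat R S := Module.Flat.of_linearEquiv
    (LinearEquiv.ofBijective (Algebra.linearMap R S) e.bijective).symm
  obtain ⟨n, hn⟩ := h M
  refine ⟨n, (hn.baseChange S).of_equiv (LinearEquiv.ofBijective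
    ((LinearMap.id : M →ₗ[R] M).liftBaseChange S) ⟨?_, fun m => ⟨1 ⊗ₜ m, by simp⟩⟩)⟩
  have key : ∀ z : S ⊗[R] M, z = 1 ⊗ₜ (LinearMap.id : M →ₗ[R] M).liftBaseChange S z := by
    intro z
    induction z with
    | zero => simp
    | add z w hz hw =>
      conv_lhs => rw [hz, hw]
      rw [map_add, TensorProduct.tmul_add]
    | tmul s m =>
      obtain ⟨r, rfl⟩ := hsurj s
      rw [LinearMap.liftBaseChange_tmul, LinearMap.id_apply, algebraMap_smul,
        TensorProduct.tmul_smul, TensorProduct.smul_tmul', Algebra.smul_def, mul_one]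
  intro z w hzw
  rw [key z, key w, hzw]

/-! ### Resolutions over `A[X]` from the degree filtration -/

section Polynomial

open Polynomial

variable {A : Type u} [CommRing A] {ι : Type} [Finite ι]

/-- The elements of `K ≤ A[X]^ι` of degree less than `d`. -/
noncomputable def Submodule.degreePart (K : Submodule A[X] (ι → A[X])) (d : ℕ) :
    Submodule A (ι → A[X]) :=
  K.restrictScalars A ⊓ Submodule.pi Set.univ fun _ => degreeLT A d

namespace Submodule.degreePart

variable (K : Submodule A[X] (ι → A[X]))

omit [Finite ι] in
theorem mem_iff {K : Submodule A[X] (ι → A[X])} {d : ℕ} {x : ι → A[X]} :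
    x ∈ K.degreePart d ↔ x ∈ K ∧ ∀ i, (x i).degree < d := by
  simp [degreePart, mem_degreeLT]

theorem finite [IsNoetherianRing A] (d : ℕ) : Module.Finite A (K.degreePart d) := by
  have : IsNoetherian A (degreeLT A d) :=
    isNoetherian_of_linearEquiv (degreeLTEquiv A d).symm
  let g : K.degreePart d →ₗ[A] (ι → degreeLT A d) := LinearMap.pi fun i =>
    ((LinearMap.proj i : (ι → A[X]) →ₗ[A] A[X]) ∘ₗ (K.degreePart d).subtype).codRestrict _
      fun x => mem_degreeLT.2 ((mem_iff.1 x.2).2 i)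
  have hg : Function.Injective g := by
    intro x y h
    refine Subtype.ext (funext fun i => ?_)
    exact congrArg Subtype.val (congrFun h i)
  have : IsNoetherian A (K.degreePart d) := isNoetherian_of_injective g hg
  infer_instance

/-- Here `d` bounds the degrees of finitely many generators, which therefore have degree less than
`d + 1`. The successor makes this piece the target of the syzygy map out of the piece at `d`. -/
theorem exists_span_eq [IsNoetherianRing A] :
    ∃ d, Submodule.span A[X] (K.degreePart (d + 1) : Set (ι → A[X])) = K := by
  obtain ⟨S, hS⟩ := IsNoetherian.noetherian K
  cases nonempty_fintype ι
  refine ⟨S.sup fun x => Finset.univ.sup fun i => (x i).natDegree, le_antisymm ?_ ?_⟩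
  · exact Submodule.span_le.2 fun x hx => (mem_iff.1 hx).1
  · conv_lhs => rw [← hS]
    refine Submodule.span_mono fun x hx => mem_iff.2 ⟨hS ▸ Submodule.subset_span hx, fun i => ?_⟩
    refine lt_of_le_of_lt degree_le_natDegree (Nat.cast_lt.2 (Nat.lt_succ_of_le ?_))
    exact (Finset.le_sup (f := fun i => (x i).natDegree) (Finset.mem_univ i)).trans
      (Finset.le_sup (f := fun x : ι → A[X] => Finset.univ.sup fun i => (x i).natDegree) hx)

/-- The inclusion of the part of degree less than `d` into the part of degree less than `d + 1`. -/
noncomputable def incl (d : ℕ) : K.degreePart d →ₗ[A] K.degreePart (d + 1) :=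
  Submodule.inclusion fun _ hx => mem_iff.2 ⟨(mem_iff.1 hx).1, fun i =>
    ((mem_iff.1 hx).2 i).trans (Nat.cast_lt.2 d.lt_succ_self)⟩

omit [Finite ι] in
theorem X_smul_mem {d : ℕ} {x : ι → A[X]} (hx : x ∈ K.degreePart d) :
    (X : A[X]) • x ∈ K.degreePart (d + 1) := by
  refine mem_iff.2 ⟨K.smul_mem _ (mem_iff.1 hx).1, fun i => ?_⟩
  have h := (mem_iff.1 hx).2 i
  rw [Pi.smul_apply, smul_eq_mul, degree_lt_iff_coeff_zero]
  rw [degree_lt_iff_coeff_zero] at h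
  intro m hm
  obtain ⟨m, rfl⟩ : ∃ k, m = k + 1 := ⟨m - 1, by omega⟩
  rw [coeff_X_mul]
  exact h m (by omega)

/-- Multiplication by `X`, raising the degree by one. -/
noncomputable def mulX (d : ℕ) : K.degreePart d →ₗ[A] K.degreePart (d + 1) :=
  ((LinearMap.lsmul A[X] (ι → A[X]) X).restrictScalars A ∘ₗ
    (K.degreePart d).subtype).codRestrict _ fun x => X_smul_mem K x.2

/-- The map `A[X] ⊗ K_d → K`. -/
noncomputable def toModule (d : ℕ) : A[X] ⊗[A] K.degreePart d →ₗ[A[X]] K :=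
  (((K.degreePart d).subtype.codRestrict (K.restrictScalars A)
    fun x => (mem_iff.1 x.2).1 : K.degreePart d →ₗ[A] K.restrictScalars A) :
      K.degreePart d →ₗ[A] K).liftBaseChange A[X]

omit [Finite ι] in
theorem coe_toModule_tmul {d : ℕ} (p : A[X]) (x : K.degreePart d) :
    (toModule K d (p ⊗ₜ x) : ι → A[X]) = p • (x : ι → A[X]) := rfl

/-- The syzygy map `A[X] ⊗ K_d → A[X] ⊗ K_{d+1}`. -/
noncomputable def syzygy (d : ℕ) :
    A[X] ⊗[A] K.degreePart d →ₗ[A[X]] A[X] ⊗[A] K.degreePart (d + 1) :=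
  (X : A[X]) • (incl K d).baseChange A[X] - (mulX K d).baseChange A[X]

omit [Finite ι] in
theorem syzygy_tmul {d : ℕ} (p : A[X]) (x : K.degreePart d) :
    syzygy K d (p ⊗ₜ x) = (X * p) ⊗ₜ incl K d x - p ⊗ₜ mulX K d x := rfl

omit [Finite ι] in
theorem coe_incl {d : ℕ} (x : K.degreePart d) : (incl K d x : ι → A[X]) = x := by
  rw [incl, Submodule.coe_inclusion]

omit [Finite ι] in
theorem coe_mulX {d : ℕ} (x : K.degreePart d) : (mulX K d x : ι → A[X]) = (X : A[X]) • x := rfl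

/-- Padding with zeros makes the sum run over an initial range, which permits induction on the top
exponent. -/
theorem _root_.Polynomial.exists_tensor_eq_sum {M : Type u} [AddCommGroup M] [Module A M]
    (z : A[X] ⊗[A] M) : ∃ (n : ℕ) (p : ℕ → M),
      z = ∑ i ∈ Finset.range (n + 1), ((X : A[X]) ^ i) ⊗ₜ[A] (p i) := by
  obtain ⟨c, rfl⟩ := (TensorProduct.equivFinsuppOfBasisLeft (basisMonomials A)).symm.surjective z
  refine ⟨c.support.sup id, c, ?_⟩
  rw [TensorProduct.equivFinsuppOfBasisLeft_symm_apply, Finsupp.sum]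
  simp only [coe_basisMonomials, ← monomial_one_right_eq_X_pow]
  refine Finset.sum_subset (fun i hi => Finset.mem_range.2
    (Nat.lt_succ_of_le (Finset.le_sup (f := id) hi))) fun i _ hi => ?_
  rw [Finsupp.notMem_support_iff.1 hi, TensorProduct.tmul_zero]

/-- The coefficient of `X ^ j` of an element of `A[X] ⊗ M`. -/
noncomputable def _root_.Polynomial.tensorCoeff {M : Type u} [AddCommGroup M] [Module A M] (j : ℕ) :
    A[X] ⊗[A] M →ₗ[A] M :=
  Finsupp.lapply j ∘ₗ (TensorProduct.equivFinsuppOfBasisLeft (basisMonomials A)).toLinearMap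

theorem _root_.Polynomial.tensorCoeff_tmul {M : Type u} [AddCommGroup M] [Module A M] (j : ℕ)
    (p : A[X]) (m : M) : tensorCoeff j (p ⊗ₜ[A] m) = p.coeff j • m :=
  TensorProduct.equivFinsuppOfBasisLeft_apply_tmul_apply _ _ _ _

theorem _root_.Polynomial.eq_zero_of_tensorCoeff {M : Type u} [AddCommGroup M] [Module A M]
    {z : A[X] ⊗[A] M} (h : ∀ j, tensorCoeff j z = 0) : z = 0 :=
  (TensorProduct.equivFinsuppOfBasisLeft (basisMonomials A)).injective
    ((Finsupp.ext h).trans (map_zero _).symm)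

omit [Finite ι] in
theorem tensorCoeff_zero_syzygy {d : ℕ} (z : A[X] ⊗[A] K.degreePart d) :
    tensorCoeff 0 (syzygy K d z) = -mulX K d (tensorCoeff 0 z) := by
  induction z with
  | zero => simp
  | add z w hz hw => simp only [map_add, hz, hw, neg_add]
  | tmul p x => simp [syzygy_tmul, tensorCoeff_tmul]

omit [Finite ι] in
theorem tensorCoeff_succ_syzygy {d : ℕ} (j : ℕ) (z : A[X] ⊗[A] K.degreePart d) :
    tensorCoeff (j + 1) (syzygy K d z) =
      incl K d (tensorCoeff j z) - mulX K d (tensorCoeff (j + 1) z) := by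
  induction z with
  | zero => simp
  | add z w hz hw =>
    simp only [map_add, hz, hw]
    abel
  | tmul p x => simp [syzygy_tmul, tensorCoeff_tmul]

omit [Finite ι] in
theorem mulX_injective (d : ℕ) : Function.Injective (mulX K d) := by
  intro x y h
  refine Subtype.ext (funext fun i => ?_)
  have := congrFun (congrArg Subtype.val h) i
  rw [coe_mulX, coe_mulX, Pi.smul_apply, Pi.smul_apply, smul_eq_mul, smul_eq_mul] at this
  exact monic_X.isRegular.left this

-- If `z = ∑ X^j ⊗ z_j` is killed, the coefficients satisfy `X z_0 = 0` and `X z_(j+1) = z_j`. As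
-- multiplication by `X` is injective, all `z_j` vanish, from the lowest one upwards.
omit [Finite ι] in
theorem syzygy_injective (d : ℕ) : Function.Injective (syzygy K d) := by
  rw [injective_iff_map_eq_zero]
  intro z hz
  refine eq_zero_of_tensorCoeff fun j => mulX_injective K d ?_
  rw [map_zero]
  induction j with
  | zero => rw [← neg_eq_zero, ← tensorCoeff_zero_syzygy, hz, map_zero]
  | succ j ih =>
    have h0 : tensorCoeff j z = 0 := mulX_injective K d (ih.trans (map_zero _).symm)
    have := tensorCoeff_succ_syzygy K j z
    rwa [hz, map_zero, h0, map_zero, zero_sub, eq_comm, neg_eq_zero] at this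

omit [Finite ι] in
theorem mem_of_X_pow_smul {d n : ℕ} {x : ι → A[X]} (hx : x ∈ K)
    (h : ∀ i, (X ^ n * x i).degree < ((n + d : ℕ) : WithBot ℕ)) : x ∈ K.degreePart d := by
  refine mem_iff.2 ⟨hx, fun i => (degree_lt_iff_coeff_zero _ _).2 fun m hm => ?_⟩
  have := (degree_lt_iff_coeff_zero _ _).1 (h i) (m + n) (by omega)
  rwa [coeff_X_pow_mul] at this

-- The relation expresses `X^(n+1) p_(n+1)` through terms of degree less than `n + 1 + d`, so the
-- top coefficient has degree less than `d` and lies in the smaller piece. Subtracting the syzygy of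
-- `X^n ⊗ p_(n+1)` removes it at the cost of replacing `p_n` by `p_n + X p_(n+1)`, which lowers `n`.
omit [Finite ι] in
theorem sum_mem_range_syzygy {d : ℕ} (n : ℕ) (p : ℕ → K.degreePart (d + 1))
    (h : ∑ i ∈ Finset.range (n + 1), (X : A[X]) ^ i • (p i : ι → A[X]) = 0) :
    ∑ i ∈ Finset.range (n + 1), ((X : A[X]) ^ i) ⊗ₜ[A] (p i) ∈ LinearMap.range (syzygy K d) := by
  induction n generalizing p with
  | zero =>
    have : p 0 = 0 := Subtype.ext (by simpa using h)
    simp [this]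
  | succ n ih =>
    rw [Finset.sum_range_succ, add_comm, ← eq_neg_iff_add_eq_zero] at h
    have hq : (p (n + 1) : ι → A[X]) ∈ K.degreePart d := by
      refine mem_of_X_pow_smul K (n := n + 1) (mem_iff.1 (p (n + 1)).2).1 fun i => ?_
      have hi := congrFun h i
      rw [Pi.smul_apply, smul_eq_mul] at hi
      rw [hi, Pi.neg_apply, degree_neg, Finset.sum_apply]
      refine mem_degreeLT.1 (Submodule.sum_mem _ fun j hj => mem_degreeLT.2 ?_)
      rw [Pi.smul_apply, smul_eq_mul, degree_lt_iff_coeff_zero]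
      intro m hm
      have hj' := Finset.mem_range.1 hj
      obtain ⟨m, rfl⟩ : ∃ k, m = k + j := ⟨m - j, by omega⟩
      rw [coeff_X_pow_mul]
      exact (degree_lt_iff_coeff_zero _ _).1 ((mem_iff.1 (p j).2).2 i) m (by omega)
    set q : K.degreePart d := ⟨_, hq⟩ with hq'
    have hincl : p (n + 1) = incl K d q := Subtype.ext (coe_incl K q).symm
    have hupd : ∀ i ∈ Finset.range n, Function.update p n (p n + mulX K d q) i = p i := fun i hi =>
      Function.update_of_ne (Finset.mem_range.1 hi).ne _ _
    have key : ∑ i ∈ Finset.range (n + 1 + 1), ((X : A[X]) ^ i) ⊗ₜ[A] (p i) =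
        syzygy K d ((X ^ n) ⊗ₜ q) + ∑ i ∈ Finset.range (n + 1), ((X : A[X]) ^ i) ⊗ₜ[A]
          (Function.update p n (p n + mulX K d q) i) := by
      rw [Finset.sum_range_succ, Finset.sum_range_succ, Finset.sum_range_succ _ n, syzygy_tmul,
        Function.update_self, TensorProduct.tmul_add, ← hincl, ← pow_succ']
      have : ∑ i ∈ Finset.range n, ((X : A[X]) ^ i) ⊗ₜ[A]
          (Function.update p n (p n + mulX K d q) i) =
          ∑ i ∈ Finset.range n, ((X : A[X]) ^ i) ⊗ₜ[A] (p i) :=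
        Finset.sum_congr rfl fun i hi => by rw [hupd i hi]
      rw [this]
      abel
    rw [key]
    refine add_mem ⟨_, rfl⟩ (ih _ ?_)
    have : ∑ i ∈ Finset.range n, (X : A[X]) ^ i •
        (Function.update p n (p n + mulX K d q) i : ι → A[X]) =
        ∑ i ∈ Finset.range n, (X : A[X]) ^ i • (p i : ι → A[X]) :=
      Finset.sum_congr rfl fun i hi => by rw [hupd i hi]
    rw [Finset.sum_range_succ, Function.update_self, this]
    rw [eq_neg_iff_add_eq_zero, Finset.sum_range_succ] at h
    rw [← h, Submodule.coe_add, coe_mulX, smul_add, smul_smul, ← pow_succ]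
    abel

omit [Finite ι] in
theorem range_syzygy (d : ℕ) : LinearMap.range (syzygy K d) = LinearMap.ker (toModule K (d + 1)) := by
  apply le_antisymm
  · rintro _ ⟨z, rfl⟩
    rw [LinearMap.mem_ker]
    induction z with
    | zero => simp
    | add z w hz hw => rw [map_add, map_add, hz, hw, add_zero]
    | tmul p x =>
      rw [syzygy_tmul, map_sub, sub_eq_zero]
      refine Subtype.ext ?_
      rw [coe_toModule_tmul, coe_toModule_tmul, coe_mulX, coe_incl, smul_smul, mul_comm]
  · intro z hz
    obtain ⟨n, p, rfl⟩ := exists_tensor_eq_sum z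
    refine sum_mem_range_syzygy K n p ?_
    have := congrArg Subtype.val (LinearMap.mem_ker.1 hz)
    rw [map_sum] at this
    simpa [coe_toModule_tmul] using this

omit [Finite ι] in
theorem toModule_surjective {d : ℕ}
    (h : Submodule.span A[X] (K.degreePart d : Set (ι → A[X])) = K) :
    Function.Surjective (toModule K d) := by
  have h' : K ≤ (LinearMap.range (toModule K d)).map K.subtype := by
    conv_lhs => rw [← h]
    refine Submodule.span_le.2 fun x hx => ?_
    exact ⟨_, ⟨1 ⊗ₜ ⟨x, hx⟩, rfl⟩, one_smul _ x⟩
  rintro ⟨x, hx⟩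
  obtain ⟨_, ⟨z, rfl⟩, hz⟩ := h' hx
  exact ⟨z, Subtype.ext hz⟩

end Submodule.degreePart

open Submodule.degreePart

/-- Over `A[X]`, all finite modules have finite free resolutions if this holds over `A`. -/
theorem HasFiniteFreeResolutions.polynomial [IsNoetherianRing A] (h : HasFiniteFreeResolutions A) :
    HasFiniteFreeResolutions A[X] := by
  intro M _ _ _
  obtain ⟨r, f, hf⟩ := Module.Finite.exists_fin' A[X] M
  set K := LinearMap.ker f with hK
  obtain ⟨d, hd⟩ := exists_span_eq K
  have := Submodule.degreePart.finite K d
  have := Submodule.degreePart.finite K (d + 1)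
  obtain ⟨n, hn⟩ := h (K.degreePart d)
  obtain ⟨m, hm⟩ := h (K.degreePart (d + 1))
  have h1 := (hn.mono (le_max_left n m)).baseChange A[X]
  have h2 := (hm.mono (le_max_right n m)).baseChange A[X]
  -- The exact sequence `0 → A[X] ⊗ K_d → A[X] ⊗ K_(d+1) → K → 0` costs one step, and the
  -- presentation `0 → K → A[X]^r → M → 0` another.
  refine ⟨max n m + 1 + 1, Fin r → A[X], _, _, inferInstance, inferInstance, f, hf,
    HasFreeResolutionLE.of_surjective (toModule K (d + 1)) (toModule_surjective K hd)
      (h1.of_equiv ?_) h2⟩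
  exact (LinearEquiv.ofInjective _ (syzygy_injective K d)).trans
    (LinearEquiv.ofEq _ _ (range_syzygy K d))

end Polynomial

end FreeResolutions

/-! ### Removing a polynomial variable from a form -/

section Linearization

open Polynomial Matrix

/-- A square root of `1 + X` modulo a power of `X`. -/
theorem Polynomial.exists_sq_approx {R : Type*} [CommRing R] {c : R} (hc : c + c = 1) (k : ℕ) :
    ∃ q : R[X], X ∣ q - 1 ∧ X ^ (k + 1) ∣ q * q - (1 + X) := by
  induction k with
  | zero => exact ⟨1, by simp, ⟨-1, by ring⟩⟩
  | succ k ih =>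
    obtain ⟨q, ⟨a, ha⟩, ⟨b, hb⟩⟩ := ih
    have hC : (C c + C c : R[X]) = 1 := by rw [← C_add, hc, C_1]
    -- Newton's step with `1 / (2 q)` replaced by `c = 1 / 2`, which is accurate enough because `q ≡
    -- 1` modulo `X`.
    refine ⟨q - C c * (q * q - (1 + X)), ⟨a - C c * X ^ k * b, ?_⟩,
      ⟨-a * b + C c * C c * X ^ k * b * b, ?_⟩⟩
    · rw [hb]
      linear_combination ha
    · linear_combination -(q * (q * q - (1 + X))) * hC - (q - 1) * hb - X ^ (k + 1) * b * ha +
        C c * C c * (q * q - (1 + X) + X ^ (k + 1) * b) * hb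

variable {ι : Type} [Fintype ι] [DecidableEq ι]

theorem Matrix.exists_sq_eq_one_add {R : Type*} [CommRing R] {c : R} (hc : c + c = 1)
    {M : Matrix ι ι R} (hM : IsNilpotent M) : ∃ q : R[X], aeval M q * aeval M q = 1 + M := by
  obtain ⟨k, hk⟩ := hM
  obtain ⟨q, -, ⟨b, hb⟩⟩ := exists_sq_approx hc k
  refine ⟨q, sub_eq_zero.1 ?_⟩
  have := congrArg (aeval M) hb
  rw [map_mul, map_pow, aeval_X, pow_succ, hk, zero_mul, zero_mul] at this
  simpa using this

/-- The hypothesis says that `M` is self-adjoint for `G`. For `V` a polynomial in `M` it follows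
that `Vᵀ G V = G V²`, so a polynomial square root of `1 + M` is a congruence from `G` to `G (1 +
M)`. -/
theorem Matrix.transpose_aeval_mul {R : Type*} [CommRing R] {M G : Matrix ι ι R}
    (h : Mᵀ * G = G * M) (q : R[X]) : (aeval M q)ᵀ * G = G * aeval M q := by
  induction q using Polynomial.induction_on' with
  | add p q hp hq => rw [map_add, transpose_add, Matrix.add_mul, hp, hq, Matrix.mul_add]
  | monomial n a =>
    rw [aeval_monomial, ← Algebra.smul_def, transpose_smul, transpose_pow, Matrix.smul_mul,
      Matrix.mul_smul]
    congr 1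
    exact ((show SemiconjBy G M Mᵀ from h.symm).pow_right n).eq.symm

variable {A : Type u} [CommRing A]

/-- The coefficients of the inverse of `1 + X N` satisfy the recursion of the geometric series and
are the powers of `-N`. Since the inverse has polynomial entries, these powers vanish eventually. -/
theorem Matrix.isNilpotent_of_isUnit_one_add_X_smul {N : Matrix ι ι A}
    (h : IsUnit (1 + (X : A[X]) • N.map C)) : IsNilpotent N := by
  obtain ⟨Q, hQ⟩ := h.exists_right_inv
  have hQ' : ∀ i k, Q i k + X * ∑ l, C (N i l) * Q l k = (1 : Matrix ι ι A[X]) i k := by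
    intro i k
    rw [← hQ, Matrix.add_mul, Matrix.one_mul, Matrix.smul_mul]
    simp [Matrix.mul_apply]
  have key : ∀ j, Q.map (fun p => p.coeff j) = (-N) ^ j := by
    intro j
    induction j with
    | zero =>
      ext i k
      have := congrArg (fun p => p.coeff 0) (hQ' i k)
      simp only [coeff_add, mul_coeff_zero, coeff_X_zero, zero_mul, add_zero] at this
      rw [map_apply, this, pow_zero, one_apply, one_apply]
      split_ifs <;> simp
    | succ j ih =>
      ext i k
      have := congrArg (fun p => p.coeff (j + 1)) (hQ' i k)
      have h0 : ((1 : Matrix ι ι A[X]) i k).coeff (j + 1) = 0 := by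
        rw [one_apply]
        split_ifs <;> simp [coeff_one]
      simp only [coeff_add, coeff_X_mul, finsetSum_coeff, coeff_C_mul, h0] at this
      rw [pow_succ', ← ih, Matrix.mul_apply, map_apply, eq_neg_of_add_eq_zero_left this]
      simp [Finset.sum_neg_distrib]
  refine (isNilpotent_neg_iff).1 ⟨(Finset.univ.sup fun p : ι × ι => (Q p.1 p.2).natDegree) + 1, ?_⟩
  rw [← key]
  ext i k
  refine coeff_eq_zero_of_natDegree_lt (Nat.lt_succ_of_le ?_)
  exact Finset.le_sup (f := fun p : ι × ι => (Q p.1 p.2).natDegree) (Finset.mem_univ (i, k))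

/-- Write `G = H + X G₁ = H (1 + M)` with `M = X H⁻¹ G₁`. Invertibility of `1 + M` makes `M`
nilpotent, and symmetry of `G₁` makes it self-adjoint for `H`, so a square root of `1 + M` carries
`H` to `G`. -/
theorem Matrix.wittClass_of_natDegree_le_one {c : A} (hc : c + c = 1) {G : Matrix ι ι A[X]}
    (hs : G.IsSymm) (hu : IsUnit G) (hd : ∀ i j, (G i j).natDegree ≤ 1) :
    ∃ H : Matrix ι ι A, H.IsSymm ∧ IsUnit H ∧ G.wittClass = (H.map C).wittClass := by
  set H : Matrix ι ι A := G.map (evalRingHom 0) with hH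
  have hHs : H.IsSymm := hs.map _
  have hHu : IsUnit H := isUnit_map hu _
  have hHd := (isUnit_iff_isUnit_det H).1 hHu
  refine ⟨H, hHs, hHu, ?_⟩
  set G₁ : Matrix ι ι A := G.map (fun p => p.coeff 1) with hG₁
  have hG₁s : G₁.IsSymm := hs.map _
  have hG : G = H.map C + (X : A[X]) • G₁.map C := by
    ext1 i j
    have := hd i j
    conv_lhs => rw [eq_X_add_C_of_natDegree_le_one this]
    simp only [add_apply, smul_apply, map_apply, hH, hG₁, coe_evalRingHom, smul_eq_mul,
      ← coeff_zero_eq_eval_zero]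
    ring
  set N := H⁻¹ * G₁ with hN
  have hHN : H * N = G₁ := by rw [hN, ← Matrix.mul_assoc, mul_nonsing_inv _ hHd, Matrix.one_mul]
  have hHCs : (H.map (C : A →+* A[X])).IsSymm := hHs.map _
  have hHCu : IsUnit (H.map (C : A →+* A[X])) := isUnit_map hHu _
  set M : Matrix ι ι A[X] := (X : A[X]) • N.map C with hM
  have hHM : H.map C * M = (X : A[X]) • G₁.map C := by
    rw [hM, Matrix.mul_smul, ← Matrix.map_mul, hHN]
  have hG' : G = H.map C * (1 + M) := by rw [Matrix.mul_add, Matrix.mul_one, hHM, hG]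
  have h1M : IsUnit (1 + M) := by
    rw [hG'] at hu
    exact (hHCu.mul_left_iff).1 hu
  have hMnil : IsNilpotent M := by
    obtain ⟨k, hk⟩ := isNilpotent_of_isUnit_one_add_X_smul h1M
    refine ⟨k, ?_⟩
    have : (N.map (C : A →+* A[X])) ^ k = 0 := by
      have := congrArg (RingHom.mapMatrix (C : A →+* A[X])) hk
      rwa [map_pow, map_zero] at this
    rw [hM, _root_.smul_pow, this, smul_zero]
  have hMs : Mᵀ * H.map C = H.map C * M := by
    rw [hHM, ← hHCs.eq, ← transpose_mul, hHM, transpose_smul, (hG₁s.map _).eq]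
  obtain ⟨q, hq⟩ := exists_sq_eq_one_add (c := C c) (by rw [← C_add, hc, C_1]) hMnil
  set V := aeval M q
  have hV : G = Vᵀ * H.map C * V := by
    rw [transpose_aeval_mul hMs, Matrix.mul_assoc, hq, hG']
  obtain ⟨W, hW⟩ := h1M.exists_right_inv
  have hVW : V * (V * W) = 1 := by rw [← Matrix.mul_assoc, hq, hW]
  rw [hV, wittClass_congruence hHCs hHCu hVW (mul_eq_one_comm.1 hVW)]

/-- Symmetric version of Higman's trick: adding a hyperbolic space lowers the degree. -/
theorem Matrix.exists_wittClass_eq_of_natDegree_le {c : A} (hc : c + c = 1) {d : ℕ} (hd : 1 ≤ d)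
    {G : Matrix ι ι A[X]} (hs : G.IsSymm) (hu : IsUnit G)
    (hdeg : ∀ i j, (G i j).natDegree ≤ d + 1) :
    ∃ G' : Matrix (ι ⊕ (ι ⊕ ι)) (ι ⊕ (ι ⊕ ι)) A[X], G'.IsSymm ∧ IsUnit G' ∧
      (∀ i j, (G' i j).natDegree ≤ d) ∧ G.wittClass = G'.wittClass := by
  set K : Matrix ι ι A := G.map (fun p => p.coeff (d + 1)) with hK
  have hKs : (K.map (C : A →+* A[X])).IsSymm := (hs.map _).map _
  -- Adding `P = (α, β)` in the hyperbolic summand to the old basis changes `G` by `αβ + βα = -2c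
  -- X^(d+1) K`, which cancels the top coefficient. The factors have degrees at most `d` and `1`,
  -- whence `1 ≤ d`.
  set α : Matrix ι ι A[X] := -((C c * X ^ d : A[X]) • K.map C) with hα
  set β : Matrix ι ι A[X] := (X : A[X]) • 1 with hβ
  have hαs : αᵀ = α := by rw [hα, transpose_neg, transpose_smul, hKs.eq]
  have hβs : βᵀ = β := by rw [hβ, transpose_smul, transpose_one]
  set H : Matrix (ι ⊕ ι) (ι ⊕ ι) A[X] := fromBlocks 0 1 1ᵀ 0 with hH
  have hHs : H.IsSymm := IsSymm.fromBlocks transpose_zero rfl isSymm_zero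
  have hHu : IsUnit H := isUnit_fromBlocks_metabolic isUnit_one 0
  set P : Matrix (ι ⊕ ι) ι A[X] := fromRows α β with hP
  have hFs : (fromBlocks G 0 0 H).IsSymm := IsSymm.fromBlocks hs transpose_zero hHs
  have hFu : IsUnit (fromBlocks G 0 0 H) := isUnit_fromBlocks_diagonal hu hHu
  set V : Matrix (ι ⊕ (ι ⊕ ι)) (ι ⊕ (ι ⊕ ι)) A[X] := fromBlocks 1 0 P 1 with hV
  set W : Matrix (ι ⊕ (ι ⊕ ι)) (ι ⊕ (ι ⊕ ι)) A[X] := fromBlocks 1 0 (-P) 1 with hW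
  have hVW : V * W = 1 := by
    rw [hV, hW, fromBlocks_multiply, ← fromBlocks_one]
    simp
  have hWV := mul_eq_one_comm.1 hVW
  have hHP : H * P = fromRows β α := by
    rw [hH, hP, fromBlocks_mul_fromRows]
    simp
  have hPHP : Pᵀ * H * P = -((X ^ (d + 1) : A[X]) • K.map C) := by
    rw [Matrix.mul_assoc, hHP, hP, transpose_fromRows, fromCols_mul_fromRows, hαs, hβs, hβ,
      Matrix.mul_smul, Matrix.smul_mul, Matrix.mul_one, Matrix.one_mul, hα, smul_neg, smul_smul,
      ← neg_add, ← add_smul]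
    congr 2
    have hC : (C c + C c : A[X]) = 1 := by rw [← C_add, hc, C_1]
    linear_combination X ^ (d + 1) * hC
  have hF : Vᵀ * fromBlocks G 0 0 H * V = fromBlocks (G - (X ^ (d + 1) : A[X]) • K.map C)
      (fromRows β α)ᵀ (fromRows β α) H := by
    rw [hV, fromBlocks_transpose, fromBlocks_multiply, fromBlocks_multiply]
    have : Pᵀ * H = (fromRows β α)ᵀ := by rw [← hHP, transpose_mul, hHs.eq]
    rw [this] at hPHP
    simp only [transpose_one, transpose_zero, Matrix.one_mul, Matrix.mul_one, Matrix.zero_mul,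
      Matrix.mul_zero, add_zero, zero_add, hPHP, hHP, this, sub_eq_add_neg]
  have hαd : ∀ i j, (α i j).natDegree ≤ d := by
    intro i j
    rw [hα, neg_apply, natDegree_neg, smul_apply, map_apply, smul_eq_mul, mul_comm, mul_comm (C c),
      ← mul_assoc]
    exact (natDegree_mul_C_le _ _).trans ((natDegree_C_mul_X_pow_le _ _))
  have hβd : ∀ i j, (β i j).natDegree ≤ d := by
    intro i j
    rw [hβ, smul_apply, one_apply, smul_eq_mul]
    split_ifs
    · rw [mul_one]
      exact natDegree_X_le.trans hd
    · simp
  have hd1 : ∀ i j, ((1 : Matrix ι ι A[X]) i j).natDegree ≤ d := by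
    intro i j
    rw [one_apply]
    split_ifs <;> simp
  refine ⟨Vᵀ * fromBlocks G 0 0 H * V, hFs.congruence V, ?_, ?_, ?_⟩
  · have hVu : IsUnit V := IsUnit.of_mul_eq_one _ hVW
    exact (((isUnit_transpose V).2 hVu).mul hFu).mul hVu
  · rw [hF]
    rintro (i | i | i) (j | j | j)
    · change (G i j - X ^ (d + 1) * C ((G i j).coeff (d + 1))).natDegree ≤ d
      refine natDegree_le_iff_coeff_eq_zero.2 fun N hN => ?_
      rw [coeff_sub, X_pow_mul, coeff_C_mul_X_pow]
      rcases (Nat.succ_le_of_lt hN).eq_or_lt with h | h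
      · rw [if_pos h.symm, ← h, sub_self]
      · rw [if_neg h.ne', sub_zero, coeff_eq_zero_of_natDegree_lt ((hdeg i j).trans_lt h)]
    · exact hβd j i
    · exact hαd j i
    · exact hβd i j
    · simp [hH]
    · exact hd1 i j
    · exact hαd i j
    · change ((1ᵀ : Matrix ι ι A[X]) i j).natDegree ≤ d
      rw [transpose_one]
      exact hd1 i j
    · simp [hH]
  · rw [wittClass_congruence hFs hFu hVW hWV, wittClass_fromBlocks_diagonal hs hu hHs hHu, hH,
      wittClass_metabolic isUnit_one isSymm_zero, add_zero]

/-- The index type is quantified after `d` because each lowering of the degree triples it. -/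
theorem Matrix.exists_wittClass_eq_map_C {c : A} (hc : c + c = 1) (d : ℕ) :
    ∀ {ι : Type} [Fintype ι] [DecidableEq ι] {G : Matrix ι ι A[X]}, G.IsSymm → IsUnit G →
      (∀ i j, (G i j).natDegree ≤ d + 1) → ∃ (κ : Type) (_ : Fintype κ) (_ : DecidableEq κ)
        (H : Matrix κ κ A), H.IsSymm ∧ IsUnit H ∧ G.wittClass = (H.map C).wittClass := by
  induction d with
  | zero =>
    intro ι _ _ G hs hu hd
    obtain ⟨H, h⟩ := wittClass_of_natDegree_le_one hc hs hu hd
    exact ⟨ι, _, _, H, h⟩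
  | succ d ih =>
    intro ι _ _ G hs hu hd
    obtain ⟨G', hs', hu', hd', h⟩ := exists_wittClass_eq_of_natDegree_le hc d.succ_pos hs hu hd
    rw [h]
    exact ih hs' hu' hd'

theorem WittGroup.matricesDescend_C {c : A} (hc : c + c = 1) :
    WittGroup.MatricesDescend (C : A →+* A[X]) := by
  intro r G hs hu
  obtain ⟨κ, _, _, H, hHs, hHu, h⟩ := Matrix.exists_wittClass_eq_map_C hc
    (Finset.univ.sup fun p : Fin r × Fin r => (G p.1 p.2).natDegree) hs hu fun i j =>
      (Finset.le_sup (f := fun p : Fin r × Fin r => (G p.1 p.2).natDegree)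
        (Finset.mem_univ (i, j))).trans (Nat.le_succ _)
  let e := (Fintype.equivFin κ).symm
  refine ⟨_, H.submatrix e e, hHs.submatrix e, (isUnit_submatrix_equiv e e).2 hHu, ?_⟩
  rw [h, ← submatrix_map, wittClass_submatrix_equiv (hHs.map _) (isUnit_map hHu _)]

end Linearization

/-! ### Pointwise positive definite forms and perturbation -/

section Positivity

open Matrix

variable {A : Type u} [CommRing A] {ι κ : Type} [Fintype ι] [DecidableEq ι] [Fintype κ]
  [DecidableEq κ]

/-- Completing the square: a block unitriangular congruence splits off `P` and leaves the Schur
complement. -/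
theorem Matrix.wittClass_fromBlocks_schur {P : Matrix ι ι A} {D : Matrix κ κ A} (hPs : P.IsSymm)
    (hPu : IsUnit P) (hDs : D.IsSymm) (B : Matrix ι κ A) (hS : IsUnit (D - Bᵀ * P⁻¹ * B)) :
    (fromBlocks P B Bᵀ D).wittClass = P.wittClass + (D - Bᵀ * P⁻¹ * B).wittClass := by
  have hPd := (isUnit_iff_isUnit_det P).1 hPu
  have hPi : P⁻¹.IsSymm := by rw [IsSymm, transpose_nonsing_inv, hPs.eq]
  have hSs : (D - Bᵀ * P⁻¹ * B).IsSymm := hDs.sub (hPi.congruence B)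
  have h0 : (fromBlocks P 0 0 (D - Bᵀ * P⁻¹ * B)).IsSymm :=
    IsSymm.fromBlocks hPs transpose_zero hSs
  have hVW : (fromBlocks 1 (P⁻¹ * B) 0 1 : Matrix (ι ⊕ κ) (ι ⊕ κ) A) *
      fromBlocks 1 (-(P⁻¹ * B)) 0 1 = 1 := by
    rw [fromBlocks_multiply, ← fromBlocks_one]
    simp
  rw [← wittClass_fromBlocks_diagonal hPs hPu hSs hS,
    ← wittClass_congruence h0 (isUnit_fromBlocks_diagonal hPu hS) hVW (mul_eq_one_comm.1 hVW)]
  congr 1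
  rw [fromBlocks_transpose, fromBlocks_multiply, fromBlocks_multiply]
  have h1 : P * (P⁻¹ * B) = B := by rw [← Matrix.mul_assoc, mul_nonsing_inv _ hPd, Matrix.one_mul]
  have h2 : (P⁻¹ * B)ᵀ * P = Bᵀ := by
    rw [transpose_mul, hPi.eq, Matrix.mul_assoc, nonsing_inv_mul _ hPd, Matrix.mul_one]
  simp only [transpose_one, transpose_zero, Matrix.one_mul, Matrix.mul_one, Matrix.zero_mul,
    Matrix.mul_zero, add_zero, zero_add, h1, h2, ← Matrix.mul_assoc]
  congr 1
  abel

variable {X : Type*} (ev : X → A →+* ℝ)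

/-- `G` is positive definite at all points of `X`. -/
def Matrix.PointwisePosDef (G : Matrix ι ι A) : Prop := ∀ x, (G.map (ev x)).PosDef

/-- An element of `A` that is positive at all points of `X` is the square of a unit. -/
def PositiveIsSquare : Prop := ∀ a : A, (∀ x, 0 < ev x a) → ∃ b, IsUnit b ∧ b * b = a

variable {ev}

/-- The square of `a` is positive everywhere, hence the square of a unit. -/
theorem PositiveIsSquare.isUnit (h : PositiveIsSquare ev) {a : A} (ha : ∀ x, ev x a ≠ 0) :
    IsUnit a := by
  obtain ⟨b, hb, h'⟩ := h (a * a) fun x => by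
    rw [map_mul]
    exact mul_self_pos.2 (ha x)
  exact isUnit_of_mul_isUnit_left (h' ▸ hb.mul hb)

namespace Matrix.PointwisePosDef

theorem congruence {G : Matrix ι ι A} (h : G.PointwisePosDef ev) {V : Matrix ι ι A}
    (hV : IsUnit V) : (Vᵀ * G * V).PointwisePosDef ev := by
  intro x
  have := (h x).conjTranspose_mul_mul_same (mulVec_injective_of_isUnit (isUnit_map hV (ev x)))
  rwa [conjTranspose_eq_transpose_of_trivial, ← transpose_map, ← Matrix.map_mul,
    ← Matrix.map_mul] at this

omit [Fintype ι] [DecidableEq ι] [Fintype κ] [DecidableEq κ] in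
theorem submatrix {G : Matrix ι ι A} (h : G.PointwisePosDef ev) {e : κ → ι}
    (he : Function.Injective e) : (G.submatrix e e).PointwisePosDef ev := fun x =>
  (h x).submatrix he

theorem isUnit (hsq : PositiveIsSquare ev) {G : Matrix ι ι A} (h : G.PointwisePosDef ev) :
    IsUnit G := by
  rw [isUnit_iff_isUnit_det]
  refine hsq.isUnit fun x => ?_
  rw [RingHom.map_det]
  exact (h x).det_pos.ne'

theorem inv (hsq : PositiveIsSquare ev) {G : Matrix ι ι A} (hs : G.IsSymm)
    (h : G.PointwisePosDef ev) : G⁻¹.PointwisePosDef ev := by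
  have hu := h.isUnit hsq
  have := h.congruence ((isUnit_nonsing_inv_iff).2 hu)
  rwa [transpose_nonsing_inv, hs.eq, nonsing_inv_mul _ ((isUnit_iff_isUnit_det G).1 hu),
    Matrix.one_mul] at this

theorem schur (hsq : PositiveIsSquare ev) {P : Matrix ι ι A} {D : Matrix κ κ A}
    {B : Matrix ι κ A} (h : (fromBlocks P B Bᵀ D).PointwisePosDef ev) :
    P.PointwisePosDef ev ∧ (D - Bᵀ * P⁻¹ * B).PointwisePosDef ev := by
  have hP : P.PointwisePosDef ev := h.submatrix Sum.inl_injective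
  have hPd := (isUnit_iff_isUnit_det P).1 (hP.isUnit hsq)
  have hVW : (fromBlocks 1 (-(P⁻¹ * B)) 0 1 : Matrix (ι ⊕ κ) (ι ⊕ κ) A) *
      fromBlocks 1 (P⁻¹ * B) 0 1 = 1 := by
    rw [fromBlocks_multiply, ← fromBlocks_one]
    simp
  have hP' : P * (P⁻¹ * B) = B := by
    rw [← Matrix.mul_assoc, mul_nonsing_inv _ hPd, Matrix.one_mul]
  refine ⟨hP, ?_⟩
  convert (h.congruence (IsUnit.of_mul_eq_one _ hVW)).submatrix (Sum.inr_injective (α := ι)) using 1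
  ext i j
  rw [fromBlocks_transpose, fromBlocks_multiply, fromBlocks_multiply, submatrix_apply,
    fromBlocks_apply₂₂]
  refine congrArg (fun M : Matrix κ κ A => M i j) ?_
  simp only [transpose_one, Matrix.one_mul, Matrix.mul_one, Matrix.mul_neg, hP',
    Matrix.add_mul, Matrix.mul_assoc, transpose_neg, Matrix.neg_mul]
  abel

/-- Gram–Schmidt: splitting off one basis vector at a time by Schur complements leaves rank-one
positive forms, each isometric to `⟨1⟩`. -/
theorem wittClass_fin (hsq : PositiveIsSquare ev) {n : ℕ} {G : Matrix (Fin n) (Fin n) A}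
    (hs : G.IsSymm) (h : G.PointwisePosDef ev) :
    G.wittClass = n • (1 : Matrix Unit Unit A).wittClass := by
  induction n with
  | zero =>
    -- The empty form is the orthogonal sum of two copies of itself, so its class is zero.
    have : G.wittClass = G.wittClass + G.wittClass := by
      have hu : IsUnit G := h.isUnit hsq
      rw [← wittClass_fromBlocks_diagonal hs hu hs hu,
        ← wittClass_submatrix_equiv hs hu (Equiv.equivOfIsEmpty (Fin 0 ⊕ Fin 0) (Fin 0))]
      congr 1
      exact Subsingleton.elim _ _
    rw [zero_smul]
    simpa using this
  | succ n ih =>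
    let e : Fin n ⊕ Unit ≃ Fin (n + 1) :=
      ((Equiv.refl (Fin n)).sumCongr (Equiv.ofUnique Unit (Fin 1))).trans finSumFinEquiv
    set G' := G.submatrix e e with hG'
    have hs' : G'.IsSymm := hs.submatrix e
    have h' : G'.PointwisePosDef ev := h.submatrix e.injective
    have hblk : G' = fromBlocks G'.toBlocks₁₁ G'.toBlocks₁₂ G'.toBlocks₁₂ᵀ G'.toBlocks₂₂ := by
      conv_lhs => rw [← fromBlocks_toBlocks G']
      congr 1
      ext i j
      exact hs'.apply (Sum.inl j) (Sum.inr i)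
    have hPs : G'.toBlocks₁₁.IsSymm := hs'.submatrix Sum.inl
    have hDs : G'.toBlocks₂₂.IsSymm := hs'.submatrix Sum.inr
    rw [hblk] at h'
    obtain ⟨hP, hS⟩ := h'.schur hsq
    set S := G'.toBlocks₂₂ - G'.toBlocks₁₂ᵀ * G'.toBlocks₁₁⁻¹ * G'.toBlocks₁₂ with hSdef
    rw [← wittClass_submatrix_equiv hs (h.isUnit hsq) e, ← hG', hblk,
      wittClass_fromBlocks_schur hPs (hP.isUnit hsq) hDs _ (hS.isUnit hsq), ih hPs hP, succ_nsmul]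
    congr 1
    -- The entry of the remaining `1 × 1` form is positive, hence `b²` for a unit `b`, and rescaling
    -- the basis vector turns it into `1`.
    obtain ⟨b, ⟨b, rfl⟩, hb⟩ := hsq (S () ()) fun x => (hS x).diag_pos
    have hSb : S = (of fun _ _ => (b : A))ᵀ * (1 : Matrix Unit Unit A) * of fun _ _ => (b : A) := by
      ext i j
      rw [Matrix.mul_one]
      simp only [mul_apply, transpose_apply, of_apply, Finset.univ_unique, Finset.sum_singleton]
      exact hb.symm
    rw [← hSdef, hSb]
    refine wittClass_congruence isSymm_one isUnit_one (W := of fun _ _ => ((b⁻¹ : Aˣ) : A)) ?_ ?_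
    all_goals
      ext i j
      simp [Matrix.mul_apply]

theorem wittClass_eq (hsq : PositiveIsSquare ev) {G : Matrix ι ι A}
    (hs : G.IsSymm) (h : G.PointwisePosDef ev) :
    G.wittClass = Fintype.card ι • (1 : Matrix Unit Unit A).wittClass := by
  let e := (Fintype.equivFin ι).symm
  rw [← wittClass_submatrix_equiv hs (h.isUnit hsq) e,
    wittClass_fin hsq (hs.submatrix e) (h.submatrix e.injective)]

/-- A form that is positive definite on one summand and negative definite on another one of the
same rank is trivial in the Witt group. -/
theorem wittClass_eq_zero (hsq : PositiveIsSquare ev) {P B D : Matrix ι ι A} (hPs : P.IsSymm)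
    (hDs : D.IsSymm) (hP : P.PointwisePosDef ev) (hD : (-D).PointwisePosDef ev) :
    (fromBlocks P B Bᵀ D).wittClass = 0 := by
  have hPi : P⁻¹.IsSymm := by rw [IsSymm, transpose_nonsing_inv, hPs.eq]
  have hSs : (D - Bᵀ * P⁻¹ * B).IsSymm := hDs.sub (hPi.congruence B)
  have hS : (-(D - Bᵀ * P⁻¹ * B)).PointwisePosDef ev := by
    intro x
    have h1 := ((hP.inv hsq hPs) x).posSemidef.conjTranspose_mul_mul_same (B.map (ev x))
    rw [conjTranspose_eq_transpose_of_trivial, ← transpose_map, ← Matrix.map_mul,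
      ← Matrix.map_mul] at h1
    have h2 := (hD x).add_posSemidef h1
    rw [← Matrix.map_add _ (map_add (ev x))] at h2
    rwa [neg_sub, sub_eq_neg_add]
  have hSu : IsUnit (D - Bᵀ * P⁻¹ * B) := by simpa using (hS.isUnit hsq).neg
  -- Both `P` and the negative of its Schur complement are positive definite of rank `card ι`, so
  -- both have class `card ι • ⟨1⟩` and the two summands cancel.
  have hS' := hS.wittClass_eq hsq hSs.neg
  rw [wittClass_neg hSs hSu] at hS'
  rw [wittClass_fromBlocks_schur hPs (hP.isUnit hsq) hDs B hSu, hP.wittClass_eq hsq hPs, ← hS',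
    neg_add_cancel]

end Matrix.PointwisePosDef

/-- Nearby symmetric forms have the same Witt class. -/
theorem Matrix.wittClass_eq_of_close (hsq : PositiveIsSquare ev) {c : A} (hc : 4 * c = 1)
    {G G' L : Matrix ι ι A} (hs : G.IsSymm) (hs' : G'.IsSymm) (hu' : IsUnit G') (hGL : G * L = 1)
    (h₁ : (1 + (1 + c • L) * (G' - G) * (1 + c • L)).PointwisePosDef ev)
    (h₂ : (1 - (1 - c • L) * (G' - G) * (1 - c • L)).PointwisePosDef ev) :
    G'.wittClass = G.wittClass := by
  have hLG : L * G = 1 := mul_eq_one_comm.1 hGL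
  have hu : IsUnit G := IsUnit.of_mul_eq_one _ hGL
  have hLs : Lᵀ = L := by
    have h : Lᵀ * G = 1 := by rw [← hs.eq, ← transpose_mul, hGL, transpose_one]
    calc Lᵀ = Lᵀ * (G * L) := by rw [hGL, Matrix.mul_one]
      _ = L := by rw [← Matrix.mul_assoc, h, Matrix.one_mul]
  -- With `L = G⁻¹` and `c = 1/4` one has `aGa - bGb = 4c = 1` and `aGb = bGa`. Hence `T`, with
  -- blocks `a b b a`, carries `G ⊥ -G` exactly to `1 ⊥ -1`, and carries `G' ⊥ -G` to a perturbation
  -- whose diagonal blocks are those in `h₁` and, up to sign, `h₂`.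
  set a := 1 + c • L with ha
  set b := 1 - c • L with hb
  have has : aᵀ = a := by rw [ha, transpose_add, transpose_one, transpose_smul, hLs]
  have hbs : bᵀ = b := by rw [hb, transpose_sub, transpose_one, transpose_smul, hLs]
  have haG : a * G = G + c • 1 := by rw [ha, Matrix.add_mul, Matrix.one_mul, Matrix.smul_mul, hLG]
  have hbG : b * G = G - c • 1 := by rw [hb, Matrix.sub_mul, Matrix.one_mul, Matrix.smul_mul, hLG]
  have haa : a * G * a = G + (2 * c) • 1 + (c * c) • L := by
    rw [haG, ha]
    simp only [Matrix.add_mul, Matrix.mul_add, Matrix.mul_one, Matrix.mul_smul, hGL,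
      Matrix.smul_mul, Matrix.one_mul]
    module
  have hbb : b * G * b = G - (2 * c) • 1 + (c * c) • L := by
    rw [hbG, hb]
    simp only [Matrix.sub_mul, Matrix.mul_sub, Matrix.mul_one, Matrix.mul_smul, hGL,
      Matrix.smul_mul, Matrix.one_mul]
    module
  have hab : a * G * b = G - (c * c) • L := by
    rw [haG, hb]
    simp only [Matrix.add_mul, Matrix.mul_sub, Matrix.mul_one, Matrix.mul_smul, hGL,
      Matrix.smul_mul, Matrix.one_mul]
    module
  have hba : b * G * a = G - (c * c) • L := by
    rw [hbG, ha]
    simp only [Matrix.sub_mul, Matrix.mul_add, Matrix.mul_one, Matrix.mul_smul, hGL,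
      Matrix.smul_mul, Matrix.one_mul]
    module
  have h4 : ((2 * c) • 1 + (2 * c) • 1 : Matrix ι ι A) = 1 := by
    rw [← add_smul, ← add_mul, show (2 + 2 : A) = 4 by norm_num, hc, one_smul]
  generalize ((2 * c) • 1 : Matrix ι ι A) = u at haa hbb h4
  set T : Matrix (ι ⊕ ι) (ι ⊕ ι) A := fromBlocks a b b a with hT
  have hcong : ∀ H : Matrix ι ι A, Tᵀ * fromBlocks H 0 0 (-G) * T =
      fromBlocks (1 + a * (H - G) * a) (a * (H - G) * b) (b * (H - G) * a)
        (-(1 - b * (H - G) * b)) := by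
    intro H
    rw [hT, fromBlocks_transpose, has, hbs, fromBlocks_multiply, fromBlocks_multiply]
    simp only [Matrix.mul_zero, add_zero, zero_add, Matrix.mul_sub, Matrix.sub_mul, Matrix.mul_neg,
      Matrix.neg_mul, haa, hbb, hab, hba]
    conv_rhs => rw [← h4]
    congr 1 <;> abel
  -- The case `G' = G` gives `Tᵀ (G ⊥ -G) T = 1 ⊥ -1`, which exhibits a left inverse of `T`.
  have hTu : IsUnit T := by
    have h := hcong G
    simp only [sub_self, Matrix.mul_zero, Matrix.zero_mul, add_zero, sub_zero] at h
    have h1 : (fromBlocks 1 0 0 (-1) : Matrix (ι ⊕ ι) (ι ⊕ ι) A) * fromBlocks 1 0 0 (-1) = 1 := by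
      rw [fromBlocks_multiply, ← fromBlocks_one]
      simp
    refine IsUnit.of_mul_eq_one_right (fromBlocks 1 0 0 (-1) * (Tᵀ * fromBlocks G 0 0 (-G))) ?_
    rw [Matrix.mul_assoc, h, h1]
  obtain ⟨W, hW⟩ := hTu.exists_right_inv
  have hEs : (G' - G).IsSymm := hs'.sub hs
  have hK := hcong G'
  have hD : (-(1 - b * (G' - G) * b)).IsSymm := by
    have := (isSymm_one.sub (hEs.congruence b)).neg
    rwa [hbs] at this
  have hP : (1 + a * (G' - G) * a).IsSymm := by
    have := isSymm_one.add (hEs.congruence a)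
    rwa [has] at this
  have hB : b * (G' - G) * a = (a * (G' - G) * b)ᵀ := by
    rw [transpose_mul, transpose_mul, hbs, has, hEs.eq, Matrix.mul_assoc]
  rw [hB] at hK
  have h0 : (Tᵀ * fromBlocks G' 0 0 (-G) * T).wittClass = 0 := by
    rw [hK]
    exact PointwisePosDef.wittClass_eq_zero hsq hP hD h₁ (by rwa [neg_neg])
  rw [wittClass_congruence (IsSymm.fromBlocks hs' transpose_zero hs.neg)
    (isUnit_fromBlocks_diagonal hu' hu.neg) hW (mul_eq_one_comm.1 hW),
    wittClass_fromBlocks_diagonal hs' hu' hs.neg hu.neg, wittClass_neg hs hu] at h0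
  exact add_neg_eq_zero.1 h0

end Positivity

/-! ### Power series and polynomials over a field -/

section PowerSeries

open Matrix

theorem WittGroup.isMatrixGenerated_of_exists_free {A : Type u} [CommRing A] [Nontrivial A]
    (h : ∀ (P : Type u) [AddCommGroup P] [Module A P] [Module.Finite A P] [Module.Projective A P],
      ∃ (F : Type u) (_ : AddCommGroup F) (_ : Module A F) (_ : Module.Finite A F)
        (_ : Module.Free A F), Module.Finite A (P × F) ∧ Module.Free A (P × F)) :
    WittGroup.IsMatrixGenerated A := by
  intro X
  obtain ⟨F, _, _, _, _, _, _⟩ := h X.carrier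
  exact SymmBilinSpace.exists_cls_eq_wittClass_of_equiv X
    (((LinearEquiv.refl A X.carrier).prodCongr (Module.finBasis A F).equivFun.symm).trans
      (Module.finBasis A (X.carrier × F)).equivFun)

theorem HasFiniteFreeResolutions.isMatrixGenerated {A : Type u} [CommRing A] [Nontrivial A]
    (h : HasFiniteFreeResolutions A) : WittGroup.IsMatrixGenerated A := by
  refine WittGroup.isMatrixGenerated_of_exists_free fun P _ _ _ _ => ?_
  obtain ⟨n, hn⟩ := h P
  exact hn.exists_stably_free

theorem WittGroup.isMatrixGenerated_of_free {A : Type u} [CommRing A] [Nontrivial A]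
    (h : ∀ (P : Type u) [AddCommGroup P] [Module A P] [Module.Finite A P] [Module.Projective A P],
      Module.Free A P) : WittGroup.IsMatrixGenerated A := by
  refine WittGroup.isMatrixGenerated_of_exists_free fun P _ _ _ _ => ?_
  have := h P
  exact ⟨PUnit, _, _, inferInstance, inferInstance, inferInstance, inferInstance⟩

theorem WittGroup.isMatrixGenerated_of_isLocalRing (A : Type u) [CommRing A] [IsLocalRing A] :
    WittGroup.IsMatrixGenerated A :=
  WittGroup.isMatrixGenerated_of_free fun _ _ _ _ _ => Module.free_of_flat_of_isLocalRing

/-- If elements with positive value at one point are squares of units, then forms are diagonalizable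
with entries ±1, up to Witt equivalence. -/
theorem WittGroup.matricesDescend_of_positiveIsSquare {A : Type} [CommRing A] (f : ℝ →+* A)
    {ε : A →+* ℝ} (hsq : PositiveIsSquare fun _ : Unit => ε) : WittGroup.MatricesDescend f := by
  intro r G hs hu
  -- The identity is the only ring endomorphism of `ℝ`.
  have hε : ε.comp f = RingHom.id ℝ := Subsingleton.elim _ _
  have hε' : ∀ x, ε (f x) = x := RingHom.congr_fun hε
  have hHs : (G.map ε).IsSymm := hs.map ε
  have hHu : IsUnit (G.map ε) := isUnit_map hu ε
  obtain ⟨L, hL⟩ := (isUnit_map hHu f).exists_right_inv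
  -- The forms `G` and `ε(G)` agree at the only point, so both matrices that must be positive
  -- definite evaluate to the identity there.
  refine ⟨r, G.map ε, hHs, hHu,
    wittClass_eq_of_close hsq (c := f (1 / 4)) ?_ (hHs.map f) hs hu hL ?_ ?_⟩
  · rw [← map_ofNat f 4, ← map_mul]
    norm_num
  all_goals
    intro _
    have h0 : ε.mapMatrix (G - (G.map ε).map f) = 0 := by
      ext i j
      simp [hε']
    change (ε.mapMatrix _).PosDef
    simp only [map_add, map_sub, map_mul] at h0 ⊢
    rw [h0]
    simpa using PosDef.one

/-- A series with constant term `c > 0` is `c (1 + u)` with `u` free of constant term. Substituting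
`u` into the binomial series of exponent `1 / 2` gives a root of `1 + u`. -/
theorem MvPowerSeries.positiveIsSquare (σ : Type) :
    PositiveIsSquare fun _ : Unit => (constantCoeff : MvPowerSeries σ ℝ →+* ℝ) := by
  intro a ha
  have hpos : 0 < constantCoeff a := ha ()
  set c : ℝ := constantCoeff a with hc
  set u : MvPowerSeries σ ℝ := C c⁻¹ * a - 1 with hu
  have hu0 : constantCoeff u = 0 := by
    rw [hu, map_sub, map_mul, constantCoeff_C, map_one, ← hc, inv_mul_cancel₀ hpos.ne', sub_self]
  have hsubst : PowerSeries.HasSubst u := PowerSeries.HasSubst.of_constantCoeff_zero hu0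
  set s := PowerSeries.substAlgHom hsubst (PowerSeries.binomialSeries ℝ (1 / 2 : ℝ)) with hs
  have hss : s * s = 1 + u := by
    rw [hs, ← map_mul, ← PowerSeries.binomialSeries_add, show (1 / 2 + 1 / 2 : ℝ) = (1 : ℕ) by
      norm_num, PowerSeries.binomialSeries_nat, pow_one, map_add, map_one,
      PowerSeries.coe_substAlgHom, PowerSeries.subst_X hsubst]
  have hb : C (Real.sqrt c) * s * (C (Real.sqrt c) * s) = a := by
    calc C (Real.sqrt c) * s * (C (Real.sqrt c) * s)
        = C (Real.sqrt c * Real.sqrt c) * (s * s) := by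
          rw [map_mul]
          ring
      _ = C c * (C c⁻¹ * a) := by rw [Real.mul_self_sqrt hpos.le, hss, hu, add_sub_cancel]
      _ = a := by rw [← mul_assoc, ← map_mul, mul_inv_cancel₀ hpos.ne', map_one, one_mul]
  refine ⟨_, ?_, hb⟩
  refine isUnit_of_mul_isUnit_left (y := C (Real.sqrt c) * s) ?_
  rw [hb, isUnit_iff_constantCoeff]
  exact hpos.ne'.isUnit

theorem MvPolynomial.hasFiniteFreeResolutions (k : Type u) [Field k] (n : ℕ) :
    HasFiniteFreeResolutions (MvPolynomial (Fin n) k) := by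
  induction n with
  | zero =>
    exact (HasFiniteFreeResolutions.of_field k).of_ringEquiv (isEmptyRingEquiv k (Fin 0)).symm
  | succ n ih => exact ih.polynomial.of_ringEquiv (finSuccEquiv k n).toRingEquiv.symm

theorem MvPolynomial.matricesDescend_algebraMap {k : Type u} [Field k] {c : k} (hc : c + c = 1)
    (n : ℕ) : WittGroup.MatricesDescend (algebraMap k (MvPolynomial (Fin n) k)) := by
  induction n with
  | zero =>
    refine WittGroup.matricesDescend_of_surjective_of_leftInverse
      (g := (isEmptyRingEquiv k (Fin 0)).toRingHom) ?_
    refine RingHom.ext fun x => ?_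
    change C (isEmptyRingEquiv k (Fin 0) x) = x
    exact (isEmptyRingEquiv k (Fin 0)).symm_apply_apply x
  | succ n ih =>
    let e := finSuccEquiv k n
    have h1 : WittGroup.MatricesDescend (e.symm.toRingEquiv.toRingHom) :=
      WittGroup.matricesDescend_of_surjective_of_leftInverse (g := e.toRingEquiv.toRingHom)
        (RingHom.ext fun x => e.symm_apply_apply x)
    have h2 : WittGroup.MatricesDescend
        (Polynomial.C : MvPolynomial (Fin n) k →+* Polynomial (MvPolynomial (Fin n) k)) :=
      WittGroup.matricesDescend_C (c := C c) (by rw [← C_add, hc, C_1])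
    have h3 : algebraMap k (MvPolynomial (Fin (n + 1)) k) =
        e.symm.toRingEquiv.toRingHom.comp (Polynomial.C.comp (algebraMap k _)) :=
      RingHom.ext fun x => (e.symm.commutes x).symm
    rw [h3]
    exact h1.comp (h2.comp ih)

end PowerSeries

/-! ### Idempotent matrices with free range -/

section FreeRange

open Matrix

variable {A : Type u} [CommRing A] {ι : Type} [Fintype ι] [DecidableEq ι]

/-- The matrix `e` is idempotent with free range. -/
def Matrix.HasFreeRange (e : Matrix ι ι A) : Prop :=
  ∃ (r : ℕ) (a : Matrix ι (Fin r) A) (b : Matrix (Fin r) ι A), a * b = e ∧ b * a = 1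

omit [DecidableEq ι] in
theorem Matrix.HasFreeRange.map {B : Type*} [CommRing B] {e : Matrix ι ι A} (h : e.HasFreeRange)
    (f : A →+* B) : (e.map f).HasFreeRange := by
  obtain ⟨r, a, b, hab, hba⟩ := h
  refine ⟨r, a.map f, b.map f, ?_, ?_⟩
  · rw [← Matrix.map_mul, hab]
  · rw [← Matrix.map_mul, hba, Matrix.map_one f (map_zero f) (map_one f)]

theorem Matrix.HasFreeRange.conj {e u v : Matrix ι ι A} (h : e.HasFreeRange) (hvu : v * u = 1) :
    (u * e * v).HasFreeRange := by
  obtain ⟨r, a, b, hab, hba⟩ := h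
  refine ⟨r, u * a, b * v, ?_, ?_⟩
  · rw [← hab]
    simp only [Matrix.mul_assoc]
  · rw [Matrix.mul_assoc, ← Matrix.mul_assoc v, hvu, Matrix.one_mul, hba]

/-- The element `u = e e' + (1 - e)(1 - e')` satisfies `e u = u e'`, so the idempotents are
conjugate when `u` is invertible. For `e = e'` it is the identity, so nearby idempotents qualify. -/
theorem Matrix.hasFreeRange_iff_of_isUnit {e e' : Matrix ι ι A} (h : e * e = e) (h' : e' * e' = e')
    (hu : IsUnit (e * e' + (1 - e) * (1 - e'))) : e.HasFreeRange ↔ e'.HasFreeRange := by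
  set u := e * e' + (1 - e) * (1 - e') with hu'
  obtain ⟨v, huv⟩ := hu.exists_right_inv
  have hvu := mul_eq_one_comm.1 huv
  have h1 : e * u = u * e' := by
    simp only [hu', Matrix.mul_add, Matrix.add_mul, Matrix.sub_mul, Matrix.mul_sub,
      Matrix.one_mul, Matrix.mul_one, Matrix.mul_assoc, h']
    simp only [← Matrix.mul_assoc, h]
    abel
  constructor
  · intro he
    have := he.conj huv
    rwa [Matrix.mul_assoc, h1, ← Matrix.mul_assoc, hvu, Matrix.one_mul] at this
  · intro he
    have := he.conj hvu
    rwa [← h1, Matrix.mul_assoc, huv, Matrix.mul_one] at this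

theorem Matrix.hasFreeRange_of_field {k : Type*} [Field k] {e : Matrix ι ι k} (h : e * e = e) :
    e.HasFreeRange := by
  set T := Matrix.toLin' e with hT
  have hTT : ∀ x, T (T x) = T x := fun x => by
    rw [← LinearMap.comp_apply, hT, ← Matrix.toLin'_mul, h]
  let b := Module.finBasis k (LinearMap.range T)
  let p : (ι → k) →ₗ[k] (Fin _ → k) := b.equivFun.toLinearMap ∘ₗ T.rangeRestrict
  let i : (Fin _ → k) →ₗ[k] (ι → k) := (LinearMap.range T).subtype ∘ₗ b.equivFun.symm.toLinearMap
  refine ⟨_, LinearMap.toMatrix' i, LinearMap.toMatrix' p, ?_, ?_⟩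
  · rw [← LinearMap.toMatrix'_comp, ← LinearMap.toMatrix'_toLin' e]
    congr 1
    refine LinearMap.ext fun x => ?_
    simp [p, i, hT]
  · rw [← LinearMap.toMatrix'_comp, ← LinearMap.toMatrix'_id]
    congr 1
    refine LinearMap.ext fun x => ?_
    have : T.rangeRestrict ((LinearMap.range T).subtype (b.equivFun.symm x)) =
        b.equivFun.symm x := by
      obtain ⟨y, hy⟩ := (b.equivFun.symm x).2
      refine Subtype.ext ?_
      change T (b.equivFun.symm x : ι → k) = (b.equivFun.symm x : ι → k)
      rw [← hy, hTT]
    change b.equivFun (T.rangeRestrict ((LinearMap.range T).subtype (b.equivFun.symm x))) = x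
    rw [this, LinearEquiv.apply_symm_apply]

/-- If idempotent matrices have free ranges, then finite projective modules are free. -/
theorem Module.free_of_hasFreeRange
    (h : ∀ (m : ℕ) (e : Matrix (Fin m) (Fin m) A), e * e = e → e.HasFreeRange)
    (P : Type*) [AddCommGroup P] [Module A P] [Module.Finite A P] [Module.Projective A P] :
    Module.Free A P := by
  obtain ⟨m, f, g, -, -, hfg⟩ := Module.Finite.exists_comp_eq_id_of_projective A P
  have hfg' : ∀ x, f (g x) = x := LinearMap.congr_fun hfg
  obtain ⟨r, a, b, hab, hba⟩ := h m (LinearMap.toMatrix' (g ∘ₗ f)) (by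
    rw [← LinearMap.toMatrix'_comp]
    congr 1
    exact LinearMap.ext fun x => congrArg g (hfg' (f x)))
  have hab' : ∀ x, Matrix.toLin' a (Matrix.toLin' b x) = g (f x) := fun x => by
    rw [← LinearMap.comp_apply, ← Matrix.toLin'_mul, hab, Matrix.toLin'_toMatrix']
    rfl
  have hba' : ∀ x, Matrix.toLin' b (Matrix.toLin' a x) = x := fun x => by
    rw [← LinearMap.comp_apply, ← Matrix.toLin'_mul, hba, Matrix.toLin'_one]
    rfl
  refine Module.Free.of_equiv (LinearEquiv.ofLinearMap (f ∘ₗ Matrix.toLin' a)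
    (Matrix.toLin' b ∘ₗ g) ?_ ?_)
  · refine LinearMap.ext fun x => ?_
    change f (Matrix.toLin' a (Matrix.toLin' b (g x))) = x
    rw [hab', hfg', hfg']
  · refine LinearMap.ext fun x => ?_
    change Matrix.toLin' b (g (f (Matrix.toLin' a x))) = x
    rw [← hab', hba', hba']

end FreeRange

/-! ### Evaluation and contraction for analytic functions on the cube -/

section CubeAnalytic

open Filter Matrix

/-- If the entries of `M - 1` are below `1 / (k + 1)`, with `k` the size, then Cauchy–Schwarz bounds
its quadratic form by `k / (k + 1)` times `∑ x_i²`, strictly less than the form of the identity. -/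
theorem Matrix.eventually_posDef_nhds_one (ι : Type) [Fintype ι] [DecidableEq ι] :
    ∀ᶠ M in 𝓝 (1 : Matrix ι ι ℝ), M.IsSymm → M.PosDef := by
  set k : ℝ := ((Fintype.card ι : ℕ) : ℝ) with hk
  have hk0 : 0 ≤ k := Nat.cast_nonneg _
  have h : ∀ i j, ∀ᶠ M in 𝓝 (1 : Matrix ι ι ℝ), |M i j - (1 : Matrix ι ι ℝ) i j| < 1 / (k + 1) := by
    intro i j
    have hc : Continuous fun M : Matrix ι ι ℝ => |M i j - (1 : Matrix ι ι ℝ) i j| := by fun_prop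
    refine hc.continuousAt.eventually_lt continuousAt_const ?_
    simp
    positivity
  filter_upwards [eventually_all.2 fun i => eventually_all.2 (h i)] with M hM hs
  refine PosDef.of_dotProduct_mulVec_pos (by rwa [IsHermitian, conjTranspose_eq_transpose_of_trivial]) ?_
  intro x hx
  have hxx : 0 < ∑ i, x i ^ 2 := by
    obtain ⟨i, hi⟩ : ∃ i, x i ≠ 0 := Function.ne_iff.1 hx
    exact Finset.sum_pos' (fun i _ => sq_nonneg _) ⟨i, Finset.mem_univ i, by positivity⟩
  have h1 : star x ⬝ᵥ (M *ᵥ x) = ∑ i, x i ^ 2 +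
      ∑ i, ∑ j, x i * (M i j - (1 : Matrix ι ι ℝ) i j) * x j := by
    have : ∑ i, x i ^ 2 = ∑ i, ∑ j, x i * (1 : Matrix ι ι ℝ) i j * x j := by
      refine Finset.sum_congr rfl fun i _ => ?_
      simp [Matrix.one_apply, sq]
    rw [this, ← Finset.sum_add_distrib, star_trivial, dotProduct]
    refine Finset.sum_congr rfl fun i _ => ?_
    rw [← Finset.sum_add_distrib, mulVec, dotProduct, Finset.mul_sum]
    exact Finset.sum_congr rfl fun j _ => by ring
  have h2 : |∑ i, ∑ j, x i * (M i j - (1 : Matrix ι ι ℝ) i j) * x j| ≤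
      1 / (k + 1) * (∑ i, |x i|) ^ 2 := by
    calc _ ≤ ∑ i, ∑ j, |x i * (M i j - (1 : Matrix ι ι ℝ) i j) * x j| :=
          (Finset.abs_sum_le_sum_abs _ _).trans
            (Finset.sum_le_sum fun i _ => Finset.abs_sum_le_sum_abs _ _)
      _ ≤ ∑ i, ∑ j, 1 / (k + 1) * (|x i| * |x j|) := by
          refine Finset.sum_le_sum fun i _ => Finset.sum_le_sum fun j _ => ?_
          rw [abs_mul, abs_mul, mul_comm |x i|, mul_assoc]
          exact mul_le_mul_of_nonneg_right (hM i j).le (by positivity)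
      _ = _ := by
          rw [sq, Finset.sum_mul_sum, Finset.mul_sum]
          exact Finset.sum_congr rfl fun i _ => by rw [Finset.mul_sum]
  have h3 : (∑ i, |x i|) ^ 2 ≤ k * ∑ i, x i ^ 2 := by
    have := sq_sum_le_card_mul_sum_sq (s := Finset.univ) (f := fun i => |x i|)
    simpa [hk] using this
  have h4 : 1 / (k + 1) * (∑ i, |x i|) ^ 2 < ∑ i, x i ^ 2 := by
    rw [one_div, inv_mul_lt_iff₀ (by positivity)]
    nlinarith
  rw [h1]
  linarith [neg_abs_le (∑ i, ∑ j, x i * (M i j - (1 : Matrix ι ι ℝ) i j) * x j)]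

namespace CubeAnalytic

variable {n : ℕ}

/-- The value at a point of the cube. -/
def eval (x : unitCube n) : CubeAnalytic n →+* ℝ where
  toFun φ := φ.1.liftOn (fun f => f x) fun _ _ h => h.self_of_nhdsSet x.2
  map_one' := rfl
  map_mul' φ ψ := by
    obtain ⟨f, hf, rfl⟩ := exists_eq_mk φ
    obtain ⟨g, hg, rfl⟩ := exists_eq_mk ψ
    rfl
  map_zero' := rfl
  map_add' φ ψ := by
    obtain ⟨f, hf, rfl⟩ := exists_eq_mk φ
    obtain ⟨g, hg, rfl⟩ := exists_eq_mk ψ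
    rfl

theorem continuous_eval (φ : CubeAnalytic n) : Continuous fun x : unitCube n => eval x φ := by
  obtain ⟨f, hf, rfl⟩ := exists_eq_mk φ
  refine continuous_iff_continuousAt.2 fun x => ?_
  exact ((isCubeAnalytic_iff.1 hf) x x.2).continuousAt.comp continuousAt_subtype_val

/-- Contraction of the cube towards the origin. -/
def contract (s : unitInterval) (x : unitCube n) : unitCube n :=
  ⟨(s : ℝ) • (x : Fin n → ℝ), fun i => mul_nonneg s.2.1 (x.2.1 i),
    fun i => mul_le_one₀ s.2.2 (x.2.1 i) (x.2.2 i)⟩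

theorem continuous_contract :
    Continuous fun p : unitInterval × unitCube n => contract p.1 p.2 := by
  refine Continuous.subtype_mk ?_ _
  fun_prop

theorem tendsto_smul_nhdsSet (s : unitInterval) :
    Tendsto (fun x : Fin n → ℝ => (s : ℝ) • x) (𝓝ˢ (unitCube n)) (𝓝ˢ (unitCube n)) :=
  (continuous_const_smul (s : ℝ)).tendsto_nhdsSet fun x hx => (contract s ⟨x, hx⟩).2

theorem _root_.IsCubeAnalytic.comp_smul {f : (Fin n → ℝ) → ℝ} (hf : IsCubeAnalytic f)
    (s : unitInterval) : IsCubeAnalytic fun x => f ((s : ℝ) • x) :=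
  isCubeAnalytic_iff.2 fun x hx =>
    ((isCubeAnalytic_iff.1 hf) _ (contract s ⟨x, hx⟩).2).comp_of_eq
      (((s : ℝ) • ContinuousLinearMap.id ℝ (Fin n → ℝ)).analyticAt x) rfl

/-- The substitution `φ ↦ φ (s • t)` for `s ∈ [0, 1]`. -/
def scale (s : unitInterval) : CubeAnalytic n →+* CubeAnalytic n where
  toFun φ := ⟨φ.1.compTendsto _ (tendsto_smul_nhdsSet s), by
    obtain ⟨_, f, hf, rfl⟩ := φ
    exact ⟨_, hf.comp_smul s, rfl⟩⟩
  map_one' := rfl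
  map_mul' φ ψ := by
    obtain ⟨f, hf, rfl⟩ := exists_eq_mk φ
    obtain ⟨g, hg, rfl⟩ := exists_eq_mk ψ
    rfl
  map_zero' := rfl
  map_add' φ ψ := by
    obtain ⟨f, hf, rfl⟩ := exists_eq_mk φ
    obtain ⟨g, hg, rfl⟩ := exists_eq_mk ψ
    rfl

theorem eval_scale (s : unitInterval) (x : unitCube n) (φ : CubeAnalytic n) :
    eval x (scale s φ) = eval (contract s x) φ := by
  obtain ⟨f, hf, rfl⟩ := exists_eq_mk φ
  rfl

theorem scale_one : scale (1 : unitInterval) = RingHom.id (CubeAnalytic n) := by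
  refine RingHom.ext fun φ => ?_
  obtain ⟨f, hf, rfl⟩ := exists_eq_mk φ
  refine mk_eq_mk (hf := hf.comp_smul 1) (hg := hf) (Eventually.of_forall fun x => ?_)
  simp

theorem scale_zero :
    scale (0 : unitInterval) = (const n).comp (eval ⟨0, zero_mem_unitCube n⟩) := by
  refine RingHom.ext fun φ => ?_
  obtain ⟨f, hf, rfl⟩ := exists_eq_mk φ
  refine mk_eq_mk (hf := hf.comp_smul 0) (hg := isCubeAnalytic_iff.2 analyticOnNhd_const)
    (Eventually.of_forall fun x => ?_)
  simp only [Set.Icc.coe_zero, zero_smul]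
  rfl

instance : CompactSpace (unitCube n) := isCompact_iff_compactSpace.1 isCompact_Icc

/-- The root is `exp (log f / 2)`. It is a unit by the functional equation of `exp`, and squares to
`f` on the neighborhood of the cube where `f` is positive. -/
theorem positiveIsSquare : PositiveIsSquare (eval (n := n)) := by
  intro φ hφ
  obtain ⟨f, hf, rfl⟩ := exists_eq_mk φ
  have hfa := isCubeAnalytic_iff.1 hf
  have hpos : ∀ x ∈ unitCube n, 0 < f x := fun x hx => hφ ⟨x, hx⟩
  have han : ∀ c : ℝ, IsCubeAnalytic fun x => Real.exp (c * Real.log (f x)) := fun c =>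
    isCubeAnalytic_iff.2 fun x hx => (analyticAt_const.mul
      ((analyticAt_log (hpos x hx)).fun_comp (hfa x hx))).rexp
  refine ⟨mk _ (han (1 / 2)), IsUnit.of_mul_eq_one (mk _ (han (-(1 / 2)))) ?_, ?_⟩
  · refine mk_eq_mk (hf := isCubeAnalytic_iff.2 ((isCubeAnalytic_iff.1 (han _)).mul
      (isCubeAnalytic_iff.1 (han _)))) (hg := isCubeAnalytic_iff.2 analyticOnNhd_const)
      (Eventually.of_forall fun x => ?_)
    simp [← Real.exp_add]
  · refine mk_eq_mk (hf := isCubeAnalytic_iff.2 ((isCubeAnalytic_iff.1 (han _)).mul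
      (isCubeAnalytic_iff.1 (han _)))) (hg := hf) ?_
    have : ∀ᶠ x in 𝓝ˢ (unitCube n), 0 < f x := eventually_nhdsSet_iff_forall.2 fun x hx =>
      (hfa x hx).continuousAt.eventually (lt_mem_nhds (hpos x hx))
    filter_upwards [this] with x hx
    change Real.exp _ * Real.exp _ = f x
    rw [← Real.exp_add, ← add_mul, add_halves, one_mul, Real.exp_log hx]

/-! ### Invariance of forms and idempotents along the contraction -/

variable {ι : Type} [Fintype ι] [DecidableEq ι]

omit [Fintype ι] [DecidableEq ι] in
theorem continuous_map_eval (G : Matrix ι ι (CubeAnalytic n)) :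
    Continuous fun x : unitCube n => G.map (eval x) :=
  continuous_matrix fun i j => continuous_eval (G i j)

omit [Fintype ι] [DecidableEq ι] in
theorem continuous_map_scale_eval (G : Matrix ι ι (CubeAnalytic n)) :
    Continuous fun p : unitInterval × unitCube n => (G.map (scale p.1)).map (eval p.2) := by
  have h := (continuous_map_eval G).comp (continuous_contract (n := n))
  refine h.congr fun p => ?_
  ext i j
  simp [eval_scale]

/-- Positivity is open near the identity, and compactness of the cube makes the neighborhood of `s`
uniform in the point. -/
theorem eventually_pointwisePosDef {s : unitInterval}
    {Φ : unitInterval → Matrix ι ι (CubeAnalytic n)}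
    (hc : Continuous fun p : unitInterval × unitCube n => (Φ p.1).map (eval p.2))
    (h1 : Φ s = 1) (hs : ∀ t, (Φ t).IsSymm) :
    ∀ᶠ t in 𝓝 s, (Φ t).PointwisePosDef eval := by
  have key : ∀ x ∈ (Set.univ : Set (unitCube n)), ∀ᶠ p in 𝓝 (s, x),
      ((Φ p.1).map (eval p.2)).PosDef := by
    intro x _
    have h := hc.tendsto (s, x)
    have e : (Φ (s, x).1).map (eval (s, x).2) = 1 := by
      rw [h1]
      exact Matrix.map_one _ (map_zero _) (map_one _)
    rw [e] at h
    filter_upwards [h.eventually (Matrix.eventually_posDef_nhds_one ι)] with p hp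
    exact hp ((hs p.1).map _)
  filter_upwards [isCompact_univ.eventually_forall_of_forall_eventually
    (P := fun t x => ((Φ t).map (eval x)).PosDef) key] with t ht x
  exact ht x (Set.mem_univ x)

/-- Both matrices required to be positive definite by `wittClass_eq_of_close` equal `1` at `t = s`
and depend continuously on `t`. -/
theorem eventually_wittClass_scale_eq {G : Matrix ι ι (CubeAnalytic n)} (hs : G.IsSymm)
    (hu : IsUnit G) (s : unitInterval) :
    ∀ᶠ t in 𝓝 s, (G.map (scale t)).wittClass = (G.map (scale s)).wittClass := by
  obtain ⟨L, hL⟩ := (isUnit_map hu (scale s)).exists_right_inv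
  have hGs : ∀ t, (G.map (scale t)).IsSymm := fun t => hs.map _
  have hLs : L.IsSymm := by
    have h : Lᵀ * G.map (scale s) = 1 := by
      rw [← (hGs s).eq, ← transpose_mul, hL, transpose_one]
    calc Lᵀ = Lᵀ * (G.map (scale s) * L) := by rw [hL, Matrix.mul_one]
      _ = L := by rw [← Matrix.mul_assoc, h, Matrix.one_mul]
  set c : CubeAnalytic n := const n (1 / 4)
  have hc : 4 * c = 1 := by
    rw [← map_ofNat (const n) 4, ← map_mul]
    norm_num
  have hcont : ∀ (u v w : Matrix ι ι (CubeAnalytic n)), Continuous fun p : unitInterval × unitCube n =>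
      (w + u * (G.map (scale p.1) - G.map (scale s)) * v).map (eval p.2) := by
    intro u v w
    have h : ∀ M : Matrix ι ι (CubeAnalytic n),
        Continuous fun p : unitInterval × unitCube n => M.map (eval p.2) := fun M =>
      (continuous_map_eval M).comp continuous_snd
    have := (h w).add (((h u).matrix_mul ((continuous_map_scale_eval G).sub
      (h (G.map (scale s))))).matrix_mul (h v))
    refine this.congr fun p => ?_
    change _ = (eval p.2).mapMatrix _
    simp only [map_add, map_mul, map_sub]
    rfl
  have hEs : ∀ t, (G.map (scale t) - G.map (scale s)).IsSymm := fun t => (hGs t).sub (hGs s)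
  have ha : (1 + c • L)ᵀ = 1 + c • L := by
    rw [transpose_add, transpose_one, transpose_smul, hLs.eq]
  have hb : (1 - c • L)ᵀ = 1 - c • L := by
    rw [transpose_sub, transpose_one, transpose_smul, hLs.eq]
  have e1 := eventually_pointwisePosDef (s := s)
    (Φ := fun t => 1 + (1 + c • L) * (G.map (scale t) - G.map (scale s)) * (1 + c • L))
    (hcont _ _ _) (by simp) fun t => by
      have := (hEs t).congruence (1 + c • L)
      rw [ha] at this
      exact isSymm_one.add this
  -- The sign is put inside the first factor so that `hcont` covers this case too.
  have e2 := eventually_pointwisePosDef (s := s)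
    (Φ := fun t => 1 + -(1 - c • L) * (G.map (scale t) - G.map (scale s)) * (1 - c • L))
    (hcont _ _ _) (by simp) fun t => by
      have := (hEs t).congruence (1 - c • L)
      rw [hb] at this
      rw [Matrix.neg_mul, Matrix.neg_mul]
      exact isSymm_one.add this.neg
  filter_upwards [e1, e2] with t h1 h2
  refine wittClass_eq_of_close positiveIsSquare hc (hGs s) (hGs t) (isUnit_map hu _) hL h1 ?_
  rwa [Matrix.neg_mul, Matrix.neg_mul, ← sub_eq_add_neg] at h2

/-- A locally constant function on the connected interval is constant. The ends `s = 1` and `s = 0`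
are the form itself and its constant value at the origin. -/
theorem wittClass_scale_eq {G : Matrix ι ι (CubeAnalytic n)} (hs : G.IsSymm)
    (hu : IsUnit G) (s t : unitInterval) :
    (G.map (scale t)).wittClass = (G.map (scale s)).wittClass :=
  isPreconnected_univ.induction₂
    (fun s t => (G.map (scale t)).wittClass = (G.map (scale s)).wittClass)
    (fun s _ => (eventually_wittClass_scale_eq hs hu s).filter_mono nhdsWithin_le_nhds)
    (fun _ _ _ _ _ _ h k => k.trans h) (fun _ _ _ _ h => h.symm)
    (Set.mem_univ s) (Set.mem_univ t)

theorem matricesDescend_const : WittGroup.MatricesDescend (const n) := by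
  intro r G hs hu
  refine ⟨r, G.map (eval ⟨0, zero_mem_unitCube n⟩), hs.map _, isUnit_map hu _, ?_⟩
  have := wittClass_scale_eq hs hu 0 1
  rw [scale_one, scale_zero] at this
  rw [Matrix.map_map, ← RingHom.coe_comp, ← this]
  simp

/-- The intertwiner of the two idempotents is `1` at `t = s`. By compactness its determinant has no
zero on the cube for `t` near `s`, hence is a unit. -/
theorem eventually_hasFreeRange_scale_iff {e : Matrix ι ι (CubeAnalytic n)} (he : e * e = e)
    (s : unitInterval) :
    ∀ᶠ t in 𝓝 s, ((e.map (scale s)).HasFreeRange ↔ (e.map (scale t)).HasFreeRange) := by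
  have he' : ∀ t : unitInterval, e.map (scale t) * e.map (scale t) = e.map (scale t) := fun t => by
    rw [← Matrix.map_mul, he]
  set u : unitInterval → Matrix ι ι (CubeAnalytic n) := fun t =>
    e.map (scale s) * e.map (scale t) + (1 - e.map (scale s)) * (1 - e.map (scale t)) with hu
  have hc : Continuous fun p : unitInterval × unitCube n => ((u p.1).map (eval p.2)).det := by
    have h : ∀ M : Matrix ι ι (CubeAnalytic n),
        Continuous fun p : unitInterval × unitCube n => M.map (eval p.2) := fun M =>
      (continuous_map_eval M).comp continuous_snd
    have h2 := continuous_map_scale_eval e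
    have := ((h (e.map (scale s))).matrix_mul h2).add
      (((h 1).sub (h (e.map (scale s)))).matrix_mul ((h 1).sub h2))
    refine (this.congr fun p => ?_).matrix_det
    change _ = (eval p.2).mapMatrix _
    simp only [hu, map_add, map_mul, map_sub]
    rfl
  have hus : u s = 1 := by
    simp only [hu, Matrix.mul_sub, Matrix.sub_mul, he', Matrix.mul_one, Matrix.one_mul]
    abel
  have key : ∀ x ∈ (Set.univ : Set (unitCube n)), ∀ᶠ p in 𝓝 (s, x),
      ((u p.1).map (eval p.2)).det ≠ 0 := by
    intro x _
    refine hc.continuousAt.eventually_ne ?_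
    have e1 : (u (s, x).1).map (eval (s, x).2) = 1 := by
      rw [hus]
      exact Matrix.map_one _ (map_zero _) (map_one _)
    rw [e1, det_one]
    exact one_ne_zero
  filter_upwards [isCompact_univ.eventually_forall_of_forall_eventually
    (P := fun t x => ((u t).map (eval x)).det ≠ 0) key] with t ht
  refine Matrix.hasFreeRange_iff_of_isUnit (he' s) (he' t) ((isUnit_iff_isUnit_det _).2 ?_)
  refine positiveIsSquare.isUnit fun x => ?_
  rw [RingHom.map_det]
  exact ht x (Set.mem_univ x)

theorem hasFreeRange {e : Matrix ι ι (CubeAnalytic n)} (he : e * e = e) : e.HasFreeRange := by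
  have key : (e.map (scale 0)).HasFreeRange ↔ (e.map (scale 1)).HasFreeRange :=
    isPreconnected_univ.induction₂
      (fun s t => (e.map (scale s)).HasFreeRange ↔ (e.map (scale t)).HasFreeRange)
      (fun s _ => (eventually_hasFreeRange_scale_iff he s).filter_mono nhdsWithin_le_nhds)
      (fun _ _ _ _ _ _ h k => h.trans k) (fun _ _ _ _ h => h.symm)
      (Set.mem_univ (0 : unitInterval)) (Set.mem_univ 1)
  rw [scale_one, scale_zero, RingHom.coe_comp, ← Matrix.map_map] at key
  have h0 : (e.map (eval ⟨0, zero_mem_unitCube n⟩)).HasFreeRange :=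
    Matrix.hasFreeRange_of_field (by rw [← Matrix.map_mul, he])
  simpa using key.1 (h0.map (const n))

end CubeAnalytic

end CubeAnalytic

/-! ### The isomorphisms of Witt groups -/

instance CubeAnalytic.nontrivial (n : ℕ) : Nontrivial (CubeAnalytic n) :=
  RingHom.domain_nontrivial (CubeAnalytic.eval ⟨0, zero_mem_unitCube n⟩)

namespace WittGroup

theorem bijective_map_real {A : Type} [CommRing A] (f : ℝ →+* A) (ε : A →+* ℝ)
    (hA : IsMatrixGenerated A) (hf : MatricesDescend f) : Function.Bijective (map f) :=
  bijective_map_of_retraction (g := ε) (Subsingleton.elim _ _)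
    (isMatrixGenerated_of_isLocalRing ℝ) hA hf

theorem bijective_map_algebraMap_mvPolynomial (n : ℕ) :
    Function.Bijective (map (algebraMap ℝ (MvPolynomial (Fin n) ℝ))) :=
  bijective_map_real _ MvPolynomial.constantCoeff
    (MvPolynomial.hasFiniteFreeResolutions ℝ n).isMatrixGenerated
    (MvPolynomial.matricesDescend_algebraMap (c := 1 / 2) (add_halves 1) n)

theorem bijective_map_const (n : ℕ) : Function.Bijective (map (CubeAnalytic.const n)) :=
  bijective_map_real _ (CubeAnalytic.eval ⟨0, zero_mem_unitCube n⟩)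
    (isMatrixGenerated_of_free fun P =>
      Module.free_of_hasFreeRange (fun _ _ he => CubeAnalytic.hasFreeRange he) P)
    CubeAnalytic.matricesDescend_const

/-- Stated for an arbitrary `f`, so that it applies to `taylor` composed with `const` without
computing Taylor series of constants. -/
theorem bijective_map_mvPowerSeries (n : ℕ) (f : ℝ →+* MvPowerSeries (Fin n) ℝ) :
    Function.Bijective (map f) :=
  bijective_map_real _ MvPowerSeries.constantCoeff (isMatrixGenerated_of_isLocalRing _)
    (matricesDescend_of_positiveIsSquare f (MvPowerSeries.positiveIsSquare (Fin n)))

/-- Induced maps satisfy two-out-of-three: if `f` and `g ∘ f` are bijective on Witt groups, then so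
is `g`. -/
theorem bijective_map_of_comp {A B C : Type u} [CommRing A] [CommRing B] [CommRing C]
    (hA : IsMatrixGenerated A) {f : A →+* B} {g : B →+* C} (hf : Function.Bijective (map f))
    (hgf : Function.Bijective (map (g.comp f))) : Function.Bijective (map g) := by
  refine (Function.Bijective.of_comp_iff _ hf).1 ?_
  convert hgf using 1
  exact funext fun w => (map_comp hA g f w).symm

end WittGroup

theorem mainTheorem6 (n : ℕ) :
    Function.Bijective (WittGroup.map (algebraMap ℝ (MvPolynomial (Fin n) ℝ))) ∧
    Function.Bijective (WittGroup.map (CubeAnalytic.ofPolynomial n)) ∧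
    Function.Bijective (WittGroup.map (CubeAnalytic.taylor n)) := by
  have hR := WittGroup.isMatrixGenerated_of_isLocalRing ℝ
  have h : (CubeAnalytic.ofPolynomial n).comp (algebraMap ℝ _) = CubeAnalytic.const n :=
    RingHom.ext fun c => MvPolynomial.eval₂Hom_C _ _ c
  exact ⟨WittGroup.bijective_map_algebraMap_mvPolynomial n,
    WittGroup.bijective_map_of_comp hR (WittGroup.bijective_map_algebraMap_mvPolynomial n)
      (h ▸ WittGroup.bijective_map_const n),
    WittGroup.bijective_map_of_comp hR (WittGroup.bijective_map_const n)
      (WittGroup.bijective_map_mvPowerSeries n _)⟩
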